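/- Let $\mathfrak t=\mathbb R^n$ with integral lattice $\mathbb Z^n$, let $\langle\cdot,\cdot\rangle$ be the standard pairing of $\mathfrak t$ with $\mathfrak t^*=\mathbb R^n$, and let $$\Delta=\Delta(\kappa)=\{\xi\in\mathfrak t^* : \langle\eta_i,\xi\rangle\le\kappa_i,\ i=1,\dots,N\},\qquad \kappa=(\kappa_1,\dots,\kappa_N)\in\mathbb R^N,$$ be a (nonempty, compact) simple smooth polytope with facets $F_i=\Delta\cap\{\langle\eta_i,\xi\rangle=\kappa_i\}\neq\emptyset$ and outward conormals $\eta_i\in\mathbb Z^n$; that is, at each vertex of $\Delta$ the conormals of the facets through that vertex form a basis of $\mathbb Z^n$. For $I\subset\{1,\dots,N\}$ put $F_I=\bigcap_{i\in I}F_i$ (with $F_\emptyset=\Delta$). The chamber $\mathcal C(\Delta)\subset\mathbb R^N$ consists of all $\kappa'$ such that $\Delta(\kappa')$ (with the same conormals) is analogous to $\Delta$, i.e. for every $I$ the face $F_I(\kappa')$ of $\Delta(\kappa')$ is nonempty if and only if $F_I$ is nonempty. Let $B_n(\kappa')$ denote the barycenter of $\Delta(\kappa')$ with respect to Lebesgue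 measure. Suppose that $H\in\mathfrak t$ is mass linear on $\Delta$ with coefficients $\gamma_1,\dots,\gamma_N\in\mathbb R$, that is, $$\langle H,B_n(\kappa')\rangle=\sum_{j=1}^N\gamma_j\kappa'_j\qquad\text{for all }\kappa'\in\mathcal C(\Delta).$$ Then: (i) $\displaystyle\sum_{j=1}^N\gamma_j=0$. (ii) $\displaystyle\sum_{\epsilon_{vj}}\ell(\epsilon_{vj})\,\gamma_j=0$, where the sum is over all directed edges $\epsilon_{vj}$ of $\Delta$ (each edge occurs once for each of its two directions). Here $\epsilon_{vj}$ denotes a directed edge that starts at the vertex $v$ and ends transversely to $F_j$, i.e. $F_j$ is the unique facet that contains the endpoint of the edge but not its starting point $v$. The affine length $\ell(\epsilon)$ of an edge $\epsilon$ with endpoints $v,w$ is the number $t\ge0$ such that $w-v=t\,u$ for a primitive vector $u\in\mathbb Z^n$. -/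

import Mathlib

/- Coordinates: the Lie algebra of the torus is `ℝⁿ` with integral lattice `ℤⁿ`, its dual is `ℝⁿ`,
and the pairing of the two is the standard dot product. -/

namespace MassLinear

open MeasureTheory

variable {n N : ℕ}

/-- An integral vector, regarded as a real vector. -/
def toReal (u : Fin n → ℤ) : Fin n → ℝ := fun k => (u k : ℝ)

/-- The polytope `Δ(κ) = {ξ : ⟨η i, ξ⟩ ≤ κ i for all i}` with outward conormals `η i ∈ ℤⁿ` and
support constants `κ i`. -/
def polytope (η : Fin N → Fin n → ℤ) (κ : Fin N → ℝ) : Set (Fin n → ℝ) :=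
  {x | ∀ i, toReal (η i) ⬝ᵥ x ≤ κ i}

/-- The facet `F i` of `Δ(κ)`, on which the `i`-th inequality is an equality. -/
def facet (η : Fin N → Fin n → ℤ) (κ : Fin N → ℝ) (i : Fin N) : Set (Fin n → ℝ) :=
  {x ∈ polytope η κ | toReal (η i) ⬝ᵥ x = κ i}

/-- The face `F_I`, the intersection of the facets `F i` for `i ∈ I`, with `F_∅ = Δ(κ)`. -/
def face (η : Fin N → Fin n → ℤ) (κ : Fin N → ℝ) (I : Finset (Fin N)) : Set (Fin n → ℝ) :=
  {x ∈ polytope η κ | ∀ i ∈ I, x ∈ facet η κ i}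

/-- `Δ(κ)` is a simple smooth (Delzant) polytope with facets `F 0, …, F (N - 1)`: it is nonempty and
bounded, and at each vertex the conormals of the facets through it form a basis of the lattice `ℤⁿ`.
Every facet contains a vertex, so these conditions imply that the polytope is `n`-dimensional, that
exactly `n` facets meet at each vertex, that the `F i` are pairwise distinct and
`(n - 1)`-dimensional, and that the `η i` are primitive. -/
structure IsSmoothPolytope (η : Fin N → Fin n → ℤ) (κ : Fin N → ℝ) : Prop where
  nonempty : (polytope η κ).Nonempty
  isBounded : Bornology.IsBounded (polytope η κ)
  facet_nonempty : ∀ i, (facet η κ i).Nonempty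
  linearIndependent : ∀ v ∈ (polytope η κ).extremePoints ℝ,
    LinearIndependent ℤ (fun i : {i : Fin N // v ∈ facet η κ i} => η i)
  span_eq_top : ∀ v ∈ (polytope η κ).extremePoints ℝ,
    Submodule.span ℤ (Set.range (fun i : {i : Fin N // v ∈ facet η κ i} => η i)) = ⊤

/-- The chamber of `Δ(κ)`: all support constants `κ'` for which `Δ(κ')` is analogous to `Δ(κ)`,
that is, has the same conormals and the same collections of facets with empty intersection.
If `Δ(κ)` is a smooth polytope then so is each such `Δ(κ')`. -/
def chamber (η : Fin N → Fin n → ℤ) (κ : Fin N → ℝ) : Set (Fin N → ℝ) :=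
  {κ' | ∀ I : Finset (Fin N), (face η κ' I).Nonempty ↔ (face η κ I).Nonempty}

/-- The barycenter (center of mass for Lebesgue measure) of `Δ(κ)`. -/
noncomputable def barycenter (η : Fin N → Fin n → ℤ) (κ : Fin N → ℝ) : Fin n → ℝ :=
  ⨍ x in polytope η κ, x

/-- `H` is mass linear on `Δ(κ)` with coefficients `γ`: on the chamber of `Δ(κ)`, the value of `H` at
the barycenter is the linear function `∑ γ j κ' j` of the support constants. -/
def MassLinearWith (η : Fin N → Fin n → ℤ) (κ : Fin N → ℝ) (H : Fin n → ℝ) (γ : Fin N → ℝ) : Prop :=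
  ∀ κ' ∈ chamber η κ, H ⬝ᵥ barycenter η κ' = ∑ j, γ j * κ' j

/-- An integral vector is primitive if it is not divisible by an integer other than `±1`. -/
def IsPrimitive (u : Fin n → ℤ) : Prop := ∀ d : ℤ, (∀ k, d ∣ u k) → IsUnit d

/-- The affine length of the segment from `v` to `w`: the `t ≥ 0` such that `w - v = t u` for a
primitive integral vector `u`. By `affineLength_eq` there is only one such `t`. -/
noncomputable def affineLength (v w : Fin n → ℝ) : ℝ :=
  sInf {t : ℝ | 0 ≤ t ∧ ∃ u : Fin n → ℤ, IsPrimitive u ∧ w - v = t • toReal u}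

/-- The directed edges `(v, w, j)` of `Δ(κ)`: some face is the nondegenerate segment from `v` to `w`,
and that edge, directed from `v` to `w`, ends transversely to `F j`, that is, its endpoint `w` lies on
`F j` and its starting point `v` does not. In a smooth polytope `j` is determined by `(v, w)`. -/
def directedEdges (η : Fin N → Fin n → ℤ) (κ : Fin N → ℝ) :
    Set ((Fin n → ℝ) × (Fin n → ℝ) × Fin N) :=
  {e | e.1 ≠ e.2.1 ∧ (∃ I, face η κ I = segment ℝ e.1 e.2.1) ∧
    e.2.1 ∈ facet η κ e.2.2 ∧ e.1 ∉ facet η κ e.2.2}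

theorem IsPrimitive.dvd_of_smul_eq {u u' : Fin n → ℤ} (hu : IsPrimitive u) {a b : ℤ}
    (h : ∀ k, a * u' k = b * u k) : a ∣ b := by
  have hg : IsUnit (Finset.univ.gcd u) := hu _ fun k => Finset.gcd_dvd (Finset.mem_univ k)
  have h1 : a ∣ Finset.univ.gcd (fun k => b * u k) :=
    Finset.dvd_gcd fun k _ => ⟨u' k, (h k).symm⟩
  rw [Finset.gcd_mul_left] at h1
  have h2 : a ∣ normalize b := (hg.dvd_mul_right).1 h1
  exact dvd_normalize_iff.1 h2

theorem affineLength_eq {v w : Fin n → ℝ} {t : ℝ} {u : Fin n → ℤ} (ht : 0 ≤ t)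
    (hu : IsPrimitive u) (h : w - v = t • toReal u) : affineLength v w = t := by
  have key : {t : ℝ | 0 ≤ t ∧ ∃ u : Fin n → ℤ, IsPrimitive u ∧ w - v = t • toReal u} = {t} := by
    have nz : ∀ u : Fin n → ℤ, IsPrimitive u → ∃ k, u k ≠ 0 := by
      intro u hu
      by_contra! h0
      have := hu 0 fun k => by simp [h0 k]
      simp at this
    ext s
    simp only [Set.mem_ofPred_eq, Set.mem_singleton_iff]
    refine ⟨?_, fun hs => hs ▸ ⟨ht, u, hu, h⟩⟩
    rintro ⟨hs, u', hu', h'⟩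
    have e : ∀ k, s * (u' k : ℝ) = t * (u k : ℝ) := fun k => by
      simpa [toReal] using congrFun (h'.symm.trans h) k
    obtain ⟨k, hk⟩ := nz u hu
    obtain ⟨l, hl⟩ := nz u' hu'
    have hl' : (u' l : ℝ) ≠ 0 := by exact_mod_cast hl
    have c : ∀ m, u' l * u m = u l * u' m ∨ t = 0 := fun m => by
      by_cases h0 : t = 0
      · exact Or.inr h0
      · left
        have : t * ((u' l : ℝ) * u m) = t * (u l * u' m) := by
          linear_combination (-(u' l : ℝ)) * e m + (u' m : ℝ) * e l
        exact_mod_cast mul_left_cancel₀ h0 this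
    by_cases h0 : t = 0
    · have := e l
      rw [h0, zero_mul] at this
      rw [h0]
      exact (mul_eq_zero.1 this).resolve_right hl'
    · have d1 : u' l ∣ u l := hu'.dvd_of_smul_eq fun m => (c m).resolve_right h0
      have d2 : u l ∣ u' l := hu.dvd_of_smul_eq fun m => ((c m).resolve_right h0).symm
      have d3 : |(u l : ℝ)| = |(u' l : ℝ)| := by
        have := Int.natAbs_eq_of_dvd_dvd d2 d1
        have h5 : |u l| = |u' l| := by rw [Int.abs_eq_natAbs, Int.abs_eq_natAbs, this]
        exact_mod_cast h5
      have := congrArg abs (e l)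
      rw [abs_mul, abs_mul, d3, abs_of_nonneg hs, abs_of_nonneg ht] at this
      exact mul_right_cancel₀ (abs_ne_zero.2 hl') this
  rw [affineLength, key, csInf_singleton]

theorem mem_pair_of_segment_eq {a b v w : Fin n → ℝ} (h : segment ℝ a b = segment ℝ v w) :
    a ∈ ({v, w} : Set (Fin n → ℝ)) := by
  have hc : IsCompact (segment ℝ a b) := by
    rw [← convexHull_pair]
    exact Set.Finite.isCompact_convexHull ℝ (Set.toFinite {a, b})
  have hE := closure_convexHull_extremePoints hc (convex_segment a b)
  have h1 : (segment ℝ a b).extremePoints ℝ ⊆ {a, b} := by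
    rw [← convexHull_pair]
    exact extremePoints_convexHull_subset
  have h2 : (segment ℝ a b).extremePoints ℝ ⊆ {v, w} := by
    rw [h, ← convexHull_pair]
    exact extremePoints_convexHull_subset
  by_cases ha : a ∈ (segment ℝ a b).extremePoints ℝ
  · exact h2 ha
  · have h3 : (segment ℝ a b).extremePoints ℝ ⊆ {b} := fun x hx => by
      rcases h1 hx with rfl | hx'
      · exact absurd hx ha
      · exact hx'
    have h4 : segment ℝ a b ⊆ {b} := by
      rw [← hE]
      refine closure_minimal (convexHull_min h3 (convex_singleton b)) isClosed_singleton
    have hab : a = b := h4 (left_mem_segment ℝ a b)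
    have hv : v = b := h4 (h ▸ left_mem_segment ℝ v w)
    exact Or.inl (hab.trans hv.symm)

theorem finite_directedEdges (η : Fin N → Fin n → ℤ) (κ : Fin N → ℝ) :
    (directedEdges η κ).Finite := by
  have h2 : (⋃ S ∈ Set.range (face η κ),
      {e : (Fin n → ℝ) × (Fin n → ℝ) | segment ℝ e.1 e.2 = S}).Finite := by
    refine (Set.finite_range (face η κ)).biUnion fun S _ => ?_
    rcases Set.eq_empty_or_nonempty {e : (Fin n → ℝ) × (Fin n → ℝ) | segment ℝ e.1 e.2 = S} with
      h0 | ⟨⟨v, w⟩, hvw⟩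
    · rw [h0]
      exact Set.finite_empty
    · refine ((Set.toFinite {v, w}).prod (Set.toFinite {v, w})).subset ?_
      rintro ⟨a, b⟩ hab
      have h : segment ℝ a b = segment ℝ v w := hab.trans hvw.symm
      exact ⟨mem_pair_of_segment_eq h, mem_pair_of_segment_eq ((segment_symm ℝ b a).trans h)⟩
  refine ((h2.prod (Set.finite_univ (α := Fin N))).image fun e => (e.1.1, e.1.2, e.2)).subset ?_
  rintro ⟨v, w, j⟩ ⟨_, ⟨I, hI⟩, _⟩
  exact ⟨((v, w), j), ⟨by simpa using ⟨I, hI.symm⟩, trivial⟩, rfl⟩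

end MassLinear

/-! Think of the variable `X i` as the divisor class of the facet F_i on the toric manifold of Δ and
of ψ as integration: a form of degree n acts on the volume as a differential operator in the support
constants. Then ψ kills every multiple of the monomial of a set of facets with empty intersection (a
nonface), kills the linear relations coming from translations of Δ, and is 1 on the monomial of a
vertex. Mass linearity says that L · vol, with L = ∑ γ_j κ_j, is the integral of H over Δ, and such
an integral is also killed by the operators of nonfaces. Let d be the derivation with d X_i = γ_i.
The Leibniz rule for L · vol in degree n + 1, where operators kill vol, shows that ψ ∘ d vanishes on
the ideal of nonfaces. Both claims follow from this (`isVolumeFunctional`).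

(i) Take a vertex w and a facet i missing w. Then X_i · ∏_{j ∈ I(w)} X_j belongs to a nonface, and
applying ψ ∘ d gives γ_i plus the γ_j of those edges at w, leaving F_j, whose other end lies on F_i.
Each edge at w ends on exactly one facet missing w, so summing over i gives ∑ γ_j = 0
(`sum_coefficients_eq_zero`).

(ii) Let y = ∑ κ_i X_i. By Leibniz, the sum over the vertices v of ψ(d(y X_{I(v)})) is |V| ∑ κ_i γ_i
plus ∑ ℓ γ over directed edges, because ψ of y times the monomial of an edge is its affine length.
The same sum is |V| ∑ κ_i γ_i by a trace computation (`sum_derivation_mul_vertex`): a generic linear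
functional gives two families of face monomials, a_v and b_v, with unitriangular intersection
matrix; d preserves triangularity, and multiplication by y is strictly triangular.

Polynomiality of the volume is not needed. Derivatives are replaced by backward differences of step
ε on germs at κ: the product of the differences over K turns an integral over Δ into the integral
over the points within ε of all the facets in K (`differenceOp_faceMonomial`). This part is empty
for a nonface and a unimodular parallelepiped of volume ε^n at a vertex. -/

set_option linter.unusedSectionVars false

namespace MassLinear

open MvPolynomial Matrix

/-! ### Intersection theory of face monomials and the trace identity. -/

section Algebra

variable {ι V k : Type*} [Fintype ι] [DecidableEq ι] [CommRing k] [Algebra ℝ k]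

/-- The squarefree monomial of a set of variables. -/
noncomputable def faceMonomial (K : Finset ι) : MvPolynomial ι ℝ := ∏ i ∈ K, X i

/-- The linear form with the given coefficients. -/
noncomputable def linearForm (c : ι → ℝ) : MvPolynomial ι ℝ := ∑ i, C (c i) * X i

/-- The derivative of polynomials in the direction `γ`. -/
noncomputable def directionalDerivation (γ : ι → ℝ) :
    Derivation ℝ (MvPolynomial ι ℝ) (MvPolynomial ι ℝ) :=
  mkDerivation ℝ fun i => C (γ i)

@[simp] theorem directionalDerivation_X (γ : ι → ℝ) (i : ι) :
    directionalDerivation γ (X i) = C (γ i) := mkDerivation_X _ _ _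

theorem directionalDerivation_linearForm (γ c : ι → ℝ) :
    directionalDerivation γ (linearForm c) = C (∑ i, c i * γ i) := by
  simp only [linearForm, map_sum, ← smul_eq_C_mul, Derivation.map_smul, directionalDerivation_X,
    map_mul]

theorem faceMonomial_insert {K : Finset ι} {i : ι} (h : i ∉ K) :
    faceMonomial (insert i K) = X i * faceMonomial K := Finset.prod_insert h

theorem directionalDerivation_faceMonomial (γ : ι → ℝ) (K : Finset ι) :
    directionalDerivation γ (faceMonomial K) = ∑ i ∈ K, C (γ i) * faceMonomial (K.erase i) := by
  induction K using Finset.induction_on with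
  | empty => simp [faceMonomial]
  | insert i K h ih =>
    rw [faceMonomial_insert h, Derivation.leibniz, ih, Finset.sum_insert h,
      directionalDerivation_X, Finset.erase_insert h, smul_eq_mul, smul_eq_mul, Finset.mul_sum,
      add_comm, mul_comm]
    congr 1
    refine Finset.sum_congr rfl fun j hj => ?_
    have hij : i ≠ j := fun e => h (e ▸ hj)
    rw [Finset.erase_insert_of_ne hij, faceMonomial_insert (by simp [h])]
    ring

/-- The combinatorial data of a simple polytope together with a generic linear functional: `V` is
the set of vertices, `I v` the set of facets through `v`, `height v` the value of the functional,
`J v` the set of facets such that `v` is the lowest point of the face `F_{J v}`, and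
`coeff v i` a relation that expresses the `i`-th variable by those of the facets missing `v`. -/
structure MorseData (ι V : Type*) [DecidableEq ι] where
  I : V → Finset ι
  J : V → Finset ι
  height : V → ℝ
  coeff : V → ι → ι → ℝ
  height_injective : Function.Injective height
  J_subset : ∀ v, J v ⊆ I v
  le_of_J_subset : ∀ v u, J v ⊆ I u → height v ≤ height u
  le_of_sdiff_subset : ∀ v u, I v \ J v ⊆ I u → height u ≤ height v
  exists_lowest : ∀ v K, K ⊆ I v → ∃ u, K ⊆ I u ∧ J u ⊆ K
  coeff_self : ∀ v, ∀ i ∈ I v, coeff v i i = 1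
  coeff_of_ne : ∀ v, ∀ i ∈ I v, ∀ j ∈ I v, j ≠ i → coeff v i j = 0

/-- A linear functional on polynomials which behaves like the top degree part of applying
differential operators to the volume of a polytope whose support constants vary, together with
a derivation that is compatible with the relations between the facets. -/
structure IsVolumeFunctional (D : MorseData ι V) (γ : ι → ℝ) (ψ : MvPolynomial ι ℝ →ₗ[ℝ] k) :
    Prop where
  nonface : ∀ K, (∀ v, ¬ K ⊆ D.I v) → ∀ Q, ψ (faceMonomial K * Q) = 0
  derivation_nonface : ∀ K, (∀ v, ¬ K ⊆ D.I v) → ∀ Q,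
    ψ (directionalDerivation γ (faceMonomial K * Q)) = 0
  relation : ∀ v, ∀ i ∈ D.I v, ∀ Q, ψ (linearForm (D.coeff v i) * Q) = 0
  vertex : ∀ v, ψ (faceMonomial (D.I v)) = 1
  mul_vertex : ∀ v i, ψ (X i * faceMonomial (D.I v)) = 0

namespace IsVolumeFunctional

variable {D : MorseData ι V} {γ : ι → ℝ} {ψ : MvPolynomial ι ℝ →ₗ[ℝ] k}

/-- The radical of the bilinear form `ψ (P * Q)`. -/
def radical (ψ : MvPolynomial ι ℝ →ₗ[ℝ] k) : Ideal (MvPolynomial ι ℝ) where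
  carrier := {P | ∀ Q, ψ (P * Q) = 0}
  add_mem' h₁ h₂ Q := by rw [add_mul, map_add, h₁, h₂, add_zero]
  zero_mem' Q := by simp
  smul_mem' R P h Q := by
    rw [smul_eq_mul, mul_comm R, mul_assoc]
    exact h _

theorem mem_radical {P : MvPolynomial ι ℝ} : P ∈ radical ψ ↔ ∀ Q, ψ (P * Q) = 0 := Iff.rfl

/-- Modulo the radical, a variable can be replaced by those of the facets missing a vertex. -/
theorem X_sub_mem_radical (h : IsVolumeFunctional D γ ψ) {v : V} {i : ι} (hi : i ∈ D.I v) :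
    X i + ∑ j ∈ (D.I v)ᶜ, C (D.coeff v i j) * X j ∈ radical ψ := by
  have : linearForm (D.coeff v i) = X i + ∑ j ∈ (D.I v)ᶜ, C (D.coeff v i j) * X j := by
    rw [linearForm, ← Finset.sum_add_sum_compl (D.I v), Finset.sum_eq_single_of_mem i hi]
    · rw [D.coeff_self v i hi, C_1, one_mul]
    · intro j hj hji
      rw [D.coeff_of_ne v i hi j hj hji, C_0, zero_mul]
  exact fun Q => this ▸ h.relation v i hi Q

/-- The span of the squarefree monomials, together with the radical, is everything. -/
theorem span_faceMonomial (h : IsVolumeFunctional D γ ψ) :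
    (radical ψ).restrictScalars ℝ ⊔ Submodule.span ℝ (Set.range faceMonomial) = ⊤ := by
  set S := (radical ψ).restrictScalars ℝ ⊔ Submodule.span ℝ (Set.range (faceMonomial (ι := ι)))
    with hS
  have hrad : ∀ P ∈ radical ψ, P ∈ S := fun P hP => (le_sup_left : _ ≤ S) hP
  have hface : ∀ K, faceMonomial K ∈ S := fun K =>
    (le_sup_right : _ ≤ S) (Submodule.subset_span ⟨K, rfl⟩)
  have hmul : ∀ (K : Finset ι) (i : ι), X i * faceMonomial K ∈ S := by
    intro K i
    by_cases hi : i ∈ K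
    · by_cases hK : ∃ v, K ⊆ D.I v
      · obtain ⟨v, hv⟩ := hK
        have h1 := hrad _ ((radical ψ).mul_mem_right (faceMonomial K)
          (h.X_sub_mem_radical (hv hi)))
        rw [add_mul, Finset.sum_mul] at h1
        -- The variables that replace `X i` belong to facets missing `v`, hence outside `K`, so the
        -- products stay squarefree.
        refine (S.add_mem_iff_left (S.sum_mem fun j hj => ?_)).1 h1
        rw [mul_assoc, ← smul_eq_C_mul, ← faceMonomial_insert]
        · exact S.smul_mem _ (hface _)
        · exact fun hjK => (Finset.mem_compl.1 hj) (hv hjK)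
      · refine hrad _ ((radical ψ).mul_mem_left _ ?_)
        exact h.nonface K (not_exists.1 hK)
    · rw [← faceMonomial_insert hi]
      exact hface _
  rw [Submodule.eq_top_iff']
  intro P
  induction P using MvPolynomial.induction_on with
  | C a =>
    have := S.smul_mem a (hface ∅)
    simpa [faceMonomial, smul_eq_C_mul] using this
  | add p q hp hq => exact S.add_mem hp hq
  | mul_X p i hp =>
    rw [mul_comm]
    obtain ⟨r, hr, s, hs, rfl⟩ := Submodule.mem_sup.1 hp
    rw [mul_add]
    refine S.add_mem (hrad _ ((radical ψ).mul_mem_left _ hr)) ?_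
    clear hp
    induction hs using Submodule.span_induction with
    | mem x hx =>
      obtain ⟨K, rfl⟩ := hx
      exact hmul K i
    | zero => simp
    | add x y _ _ hx hy =>
      rw [mul_add]
      exact S.add_mem hx hy
    | smul a x _ hx =>
      rw [mul_smul_comm]
      exact S.smul_mem _ hx

variable [Fintype V]

/-- The monomials of the faces that have a given lowest vertex span everything modulo the
radical. -/
theorem span_faceMonomial_J (h : IsVolumeFunctional D γ ψ) :
    (radical ψ).restrictScalars ℝ ⊔ Submodule.span ℝ (Set.range fun v => faceMonomial (D.J v)) =
      ⊤ := by
  classical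
  set S := (radical ψ).restrictScalars ℝ ⊔
    Submodule.span ℝ (Set.range fun v => faceMonomial (D.J v)) with hS
  have hrad : ∀ P ∈ radical ψ, P ∈ S := fun P hP => (le_sup_left : _ ≤ S) hP
  -- Induction on the number of vertices above the lowest vertex v of the face. For i ∈ K \ J(v),
  -- trade X_i for the X_j with F_j missing v. The set K \ {i} ∪ {j} still contains J(v), so its
  -- lowest vertex u is not below v, and u ≠ v because F_j misses v. Thus the height strictly
  -- increases.
  have key : ∀ (m : ℕ) (v : V) (K : Finset ι),
      (Finset.univ.filter fun u => D.height v < D.height u).card ≤ m →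
        K ⊆ D.I v → D.J v ⊆ K → faceMonomial K ∈ S := by
    intro m
    induction m with
    | zero | succ m ih
    all_goals
      intro v K hm hKI hJK
      by_cases hK : K = D.J v
      · exact (le_sup_right : _ ≤ S) (Submodule.subset_span ⟨v, hK ▸ rfl⟩)
      obtain ⟨i, hiK, hiJ⟩ : ∃ i ∈ K, i ∉ D.J v := by
        by_contra! hc
        exact hK (Finset.Subset.antisymm hc hJK)
      have h1 := hrad _ ((radical ψ).mul_mem_right (faceMonomial (K.erase i))
          (h.X_sub_mem_radical (hKI hiK)))
      rw [add_mul, Finset.sum_mul, ← faceMonomial_insert (Finset.notMem_erase i K),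
        Finset.insert_erase hiK] at h1
      refine (S.add_mem_iff_left (S.sum_mem fun j hj => ?_)).1 h1
      have hj' : j ∉ D.I v := Finset.mem_compl.1 hj
      rw [mul_assoc, ← smul_eq_C_mul, ← faceMonomial_insert
        (fun hjK => hj' (hKI (Finset.mem_of_mem_erase hjK)))]
      refine S.smul_mem _ ?_
      by_cases hf : ∃ w, insert j (K.erase i) ⊆ D.I w
      swap
      · refine hrad _ ?_
        exact h.nonface _ (not_exists.1 hf)
      obtain ⟨w, hw⟩ := hf
      obtain ⟨u, hu, huJ⟩ := D.exists_lowest w _ hw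
      have hvu : D.height v < D.height u := by
        refine lt_of_le_of_ne (D.le_of_J_subset v u fun l hl => hu ?_) fun e => ?_
        · refine Finset.mem_insert_of_mem (Finset.mem_erase.2 ⟨?_, hJK hl⟩)
          rintro rfl
          exact hiJ hl
        · exact hj' (D.height_injective e ▸ hu (Finset.mem_insert_self _ _))
      have hlt : (Finset.univ.filter fun x => D.height u < D.height x).card <
          (Finset.univ.filter fun x => D.height v < D.height x).card := by
        refine Finset.card_lt_card ⟨fun x hx => ?_, fun hc => ?_⟩
        · simp only [Finset.mem_filter, Finset.mem_univ, true_and] at hx ⊢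
          exact hvu.trans hx
        · have := hc (Finset.mem_filter.2 ⟨Finset.mem_univ u, hvu⟩)
          simp at this
      first
        | exact absurd hm (by omega)
        | exact ih u _ (by omega) hu huJ
  rw [eq_top_iff, ← h.span_faceMonomial]
  refine sup_le le_sup_left (Submodule.span_le.2 ?_)
  rintro _ ⟨K, rfl⟩
  by_cases hK : ∃ v, K ⊆ D.I v
  · obtain ⟨v, hv⟩ := hK
    obtain ⟨u, hu, huJ⟩ := D.exists_lowest v K hv
    exact key _ u K le_rfl hu huJ
  · exact hrad _ (h.nonface K (not_exists.1 hK))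

theorem exists_sub_mem_radical (h : IsVolumeFunctional D γ ψ) (P : MvPolynomial ι ℝ) :
    ∃ c : V → ℝ, ∀ Q, ψ (P * Q) = ∑ v, c v • ψ (faceMonomial (D.J v) * Q) := by
  have hP : P ∈ (radical ψ).restrictScalars ℝ ⊔
    Submodule.span ℝ (Set.range fun v => faceMonomial (D.J v)) := h.span_faceMonomial_J ▸ trivial
  obtain ⟨r, hr, s, hs, rfl⟩ := Submodule.mem_sup.1 hP
  obtain ⟨c, rfl⟩ := (Submodule.mem_span_range_iff_exists_fun ℝ).1 hs
  refine ⟨c, fun Q => ?_⟩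
  rw [add_mul, map_add, mem_radical.1 hr, zero_add, Finset.sum_mul, map_sum]
  simp

variable [DecidableEq V]

/-- The intersection matrix of the faces with given lowest vertex and those with given highest
vertex. -/
noncomputable def gram (D : MorseData ι V) (ψ : MvPolynomial ι ℝ →ₗ[ℝ] k) : Matrix V V k :=
  of fun v w => ψ (faceMonomial (D.J v) * faceMonomial (D.I w \ D.J w))

theorem faceMonomial_J_mul (D : MorseData ι V) (v : V) :
    faceMonomial (D.J v) * faceMonomial (D.I v \ D.J v) = faceMonomial (D.I v) := by
  rw [mul_comm]
  exact Finset.prod_sdiff (D.J_subset v)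

/-- A vertex u on all facets of J(v) and of I(w) \ J(w) would satisfy height v ≤ height u ≤ height
w. The cofactor is the monomial of the intersection of the two sets. This is the source of all
triangularity below. -/
theorem exists_nonface {v w : V} (hvw : D.height w < D.height v) : ∃ K, (∀ u, ¬ K ⊆ D.I u) ∧
    ∃ Q, faceMonomial (D.J v) * faceMonomial (D.I w \ D.J w) = faceMonomial K * Q := by
  refine ⟨D.J v ∪ (D.I w \ D.J w), fun u hu => ?_, _, Finset.prod_union_inter.symm⟩
  have h1 := D.le_of_J_subset v u (Finset.union_subset_left hu)
  have h2 := D.le_of_sdiff_subset w u (Finset.union_subset_right hu)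
  linarith

theorem blockTriangular_of_mul (h : IsVolumeFunctional D γ ψ) (P : MvPolynomial ι ℝ) :
    (of fun v w => ψ (P * faceMonomial (D.J v) * faceMonomial (D.I w \ D.J w)) :
      Matrix V V k).BlockTriangular D.height := by
  intro v w hvw
  obtain ⟨K, hK, Q, hQ⟩ := exists_nonface hvw
  rw [of_apply, mul_assoc, hQ, mul_left_comm]
  exact h.nonface K hK _

/-- This is where `derivation_nonface`, the trace of mass linearity, enters the trace identity; it
serves for P = y and P = 1. -/
theorem blockTriangular_of_derivation (h : IsVolumeFunctional D γ ψ) (P : MvPolynomial ι ℝ) :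
    (of fun v w => ψ (directionalDerivation γ
      (P * faceMonomial (D.J v) * faceMonomial (D.I w \ D.J w))) :
      Matrix V V k).BlockTriangular D.height := by
  intro v w hvw
  obtain ⟨K, hK, Q, hQ⟩ := exists_nonface hvw
  rw [of_apply, mul_assoc, hQ, mul_left_comm]
  exact h.derivation_nonface K hK _

theorem gram_blockTriangular (h : IsVolumeFunctional D γ ψ) :
    (gram D ψ).BlockTriangular D.height := by
  simpa [gram] using h.blockTriangular_of_mul 1

theorem mul_apply_self_of_blockTriangular {f : V → ℝ} (hf : Function.Injective f)
    {A B : Matrix V V k} (hA : A.BlockTriangular f) (hB : B.BlockTriangular f) (v : V) :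
    (A * B) v v = A v v * B v v := by
  rw [mul_apply, Finset.sum_eq_single v]
  · intro w _ hw
    rcases lt_or_gt_of_ne (hf.ne hw) with h | h
    · rw [hA h, zero_mul]
    · rw [hB h, mul_zero]
  · simp

theorem gram_apply_self (h : IsVolumeFunctional D γ ψ) (v : V) : gram D ψ v v = 1 := by
  rw [gram, of_apply, faceMonomial_J_mul, h.vertex]

theorem isUnit_det_gram (h : IsVolumeFunctional D γ ψ) : IsUnit (gram D ψ).det := by
  let _ : LinearOrder V := LinearOrder.lift' D.height D.height_injective
  have : (gram D ψ).IsUpperTriangular := fun v w hvw => h.gram_blockTriangular hvw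
  rw [det_of_isUpperTriangular this]
  simp [h.gram_apply_self]

theorem gram_inv_blockTriangular (h : IsVolumeFunctional D γ ψ) :
    (gram D ψ)⁻¹.BlockTriangular D.height := by
  let _ := (gram D ψ).invertibleOfIsUnitDet h.isUnit_det_gram
  exact blockTriangular_inv_of_blockTriangular h.gram_blockTriangular

theorem gram_inv_apply_self (h : IsVolumeFunctional D γ ψ) (v : V) : (gram D ψ)⁻¹ v v = 1 := by
  have h1 := mul_apply_self_of_blockTriangular D.height_injective h.gram_blockTriangular
    h.gram_inv_blockTriangular v
  rw [mul_nonsing_inv _ h.isUnit_det_gram, one_apply_eq, h.gram_apply_self, one_mul] at h1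
  exact h1.symm

/-- The decomposition of the diagonal. -/
theorem apply_mul_eq (h : IsVolumeFunctional D γ ψ) (P Q : MvPolynomial ι ℝ) :
    ψ (P * Q) = ((fun w => ψ (P * faceMonomial (D.I w \ D.J w))) ᵥ* (gram D ψ)⁻¹) ⬝ᵥ
      fun v => ψ (faceMonomial (D.J v) * Q) := by
  obtain ⟨c, hc⟩ := h.exists_sub_mem_radical P
  -- Modulo the radical P is ∑ c_v a_v; pairing with the b_w gives the row c times the Gram matrix,
  -- so its inverse recovers c.
  have h1 : (fun w => ψ (P * faceMonomial (D.I w \ D.J w))) =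
      (fun v => algebraMap ℝ k (c v)) ᵥ* gram D ψ := by
    ext w
    rw [hc, vecMul, dotProduct]
    simp [gram, Algebra.smul_def]
  rw [h1, vecMul_vecMul, mul_nonsing_inv _ h.isUnit_det_gram, vecMul_one, hc, dotProduct]
  simp [Algebra.smul_def]

theorem apply_mul_eq_mul_apply (h : IsVolumeFunctional D γ ψ) (P Q : V → MvPolynomial ι ℝ) :
    (of fun v w => ψ (P v * Q w) : Matrix V V k) =
      (of fun v w => ψ (P v * faceMonomial (D.I w \ D.J w))) * (gram D ψ)⁻¹ *
        of fun v w => ψ (faceMonomial (D.J v) * Q w) := by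
  ext v w
  rw [of_apply, h.apply_mul_eq]
  rfl

/-- Diagonal entries of triangular matrices multiply, so the zero diagonal of A survives all the
products. -/
theorem trace_mul_mul_eq_zero (h : IsVolumeFunctional D γ ψ) {A B : Matrix V V k}
    (hA : A.BlockTriangular D.height) (hB : B.BlockTriangular D.height) (hA0 : ∀ v, A v v = 0) :
    (A * (gram D ψ)⁻¹ * (B * (gram D ψ)⁻¹)).trace = 0 := by
  refine Finset.sum_eq_zero fun v _ => ?_
  rw [diag_apply, mul_apply_self_of_blockTriangular D.height_injective
      (hA.mul h.gram_inv_blockTriangular) (hB.mul h.gram_inv_blockTriangular),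
    mul_apply_self_of_blockTriangular D.height_injective hA h.gram_inv_blockTriangular, hA0,
    zero_mul, zero_mul]

/-- The trace of the multiplication by a degree two class, computed by localization at the vertices
on the one hand, and in a trivialization on the other. -/
theorem sum_derivation_mul_vertex (h : IsVolumeFunctional D γ ψ) (c : ι → ℝ) :
    ∑ v, ψ (directionalDerivation γ (linearForm c * faceMonomial (D.I v))) =
      algebraMap ℝ k (Fintype.card V * ∑ i, c i * γ i) := by
  set y := linearForm c with hy
  set d := directionalDerivation γ with hd
  set a : V → MvPolynomial ι ℝ := fun v => faceMonomial (D.J v) with ha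
  set b : V → MvPolynomial ι ℝ := fun w => faceMonomial (D.I w \ D.J w) with hb
  set L : ℝ := ∑ i, c i * γ i
  set G := gram D ψ with hG
  let Φ : Matrix V V k := of fun v w => ψ (d (y * a v * b w))
  let Y : Matrix V V k := of fun v w => ψ (y * a v * b w)
  let E : Matrix V V k := of fun v w => ψ (d (a v) * b w)
  let E' : Matrix V V k := of fun v w => ψ (a v * d (b w))
  let Θ : Matrix V V k := of fun v w => ψ (d (1 * a v * b w))
  have hab : ∀ v, a v * b v = faceMonomial (D.I v) := faceMonomial_J_mul D
  have hdet := h.isUnit_det_gram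
  have hE : E + E' = Θ := by
    ext v w
    simp only [E, E', Θ, Matrix.add_apply, of_apply, one_mul, ← map_add]
    rw [d.leibniz, smul_eq_mul, smul_eq_mul]
    congr 1
    ring
  -- Leibniz on the three factors y, a_v, b_w; the decomposition of the diagonal splits the two
  -- terms in which y is not differentiated.
  have hΦ : Φ = algebraMap ℝ k L • G + E * G⁻¹ * Y + Y * G⁻¹ * E' := by
    have e1 : E * G⁻¹ * Y = of fun v w => ψ (d (a v) * (y * b w)) := by
      rw [h.apply_mul_eq_mul_apply]
      congr 1
      ext v w
      simp only [Y, of_apply]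
      congr 1
      ring
    have e2 : Y * G⁻¹ * E' = of fun v w => ψ (y * a v * d (b w)) :=
      (h.apply_mul_eq_mul_apply (fun v => y * a v) _).symm
    rw [e1, e2]
    ext v w
    have e3 : d (y * a v * b w) = L • (a v * b w) + d (a v) * (y * b w) + y * a v * d (b w) := by
      rw [d.leibniz, d.leibniz, hy, hd, directionalDerivation_linearForm]
      simp only [smul_eq_mul, smul_eq_C_mul]
      ring
    change ψ (d (y * a v * b w)) = algebraMap ℝ k L • ψ (a v * b w) + ψ (d (a v) * (y * b w)) +
      ψ (y * a v * d (b w))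
    rw [e3, map_add, map_add, map_smul, algebraMap_smul]
  -- The product a_v b_v is a vertex monomial, which any further variable sends to zero under ψ.
  have hY0 : ∀ v, Y v v = 0 := fun v => by
    simp only [Y, of_apply, mul_assoc, hab, hy, linearForm, Finset.sum_mul, map_sum]
    refine Finset.sum_eq_zero fun i _ => ?_
    rw [← smul_eq_C_mul, map_smul, h.mul_vertex, smul_zero]
  have hYT : Y.BlockTriangular D.height := h.blockTriangular_of_mul y
  have hΘT : Θ.BlockTriangular D.height := h.blockTriangular_of_derivation 1
  have t1 : (Φ * G⁻¹).trace = ∑ v, ψ (d (y * faceMonomial (D.I v))) := by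
    refine Finset.sum_congr rfl fun v _ => ?_
    rw [diag_apply, mul_apply_self_of_blockTriangular D.height_injective
      (h.blockTriangular_of_derivation y) h.gram_inv_blockTriangular, h.gram_inv_apply_self,
      mul_one, of_apply, mul_assoc y (a v), hab]
  have t2 : (Φ * G⁻¹).trace = algebraMap ℝ k (Fintype.card V * L) := by
    -- Triangularity is known for the sum E + E' = Θ, not for E or E' alone. Cyclicity of the trace
    -- brings both terms to the form in which they add up.
    have s : (E * G⁻¹ * Y * G⁻¹).trace = (Y * G⁻¹ * E * G⁻¹).trace := by
      rw [mul_assoc (E * G⁻¹), trace_mul_comm, mul_assoc (Y * G⁻¹) E]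
    rw [hΦ, add_mul, add_mul, trace_add, trace_add, s, smul_mul, mul_nonsing_inv _ hdet,
      add_assoc, ← trace_add, ← add_mul, ← mul_add, hE, mul_assoc (Y * G⁻¹),
      h.trace_mul_mul_eq_zero hYT hΘT hY0, trace_smul, trace_one, add_zero, smul_eq_mul, map_mul,
      map_natCast, mul_comm]
  rw [← t1, t2]

end IsVolumeFunctional

end Algebra

end MassLinear

namespace MassLinear

open MvPolynomial

/-! ### Backward differences in place of derivatives. -/

section Shift

variable {ι V k : Type*} [Fintype ι] [DecidableEq ι] [CommRing k] [Algebra ℝ k]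

/-- The group ring of the lattice of shifts of the support constants. -/
abbrev ShiftRing (ι : Type*) := AddMonoidAlgebra ℝ (ι → ℤ)

/-- The shift by a lattice vector. -/
noncomputable def shift (u : ι → ℤ) : ShiftRing ι := AddMonoidAlgebra.single u 1

theorem shift_add (u w : ι → ℤ) : shift (u + w) = shift u * shift w := by
  simp [shift, AddMonoidAlgebra.single_mul_single]

theorem shift_zero : shift (0 : ι → ℤ) = 1 := rfl

/-- The polynomials in the backward differences. -/
noncomputable def difference : MvPolynomial ι ℝ →ₐ[ℝ] ShiftRing ι :=
  aeval fun i => 1 - shift (-Pi.single i 1)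

theorem difference_X (i : ι) : difference (X i) = 1 - shift (-Pi.single i 1) := aeval_X _ _

/-- The ideal generated by the differences in the given directions. -/
noncomputable def differenceIdeal (S : Set ι) : Ideal (ShiftRing ι) :=
  Ideal.span ((fun i => difference (X i)) '' S)

/-- The vectors u with 1 − shift u in an ideal form a subgroup, and the ideal contains the
generators for the coordinate vectors in S. -/
theorem one_sub_shift_mem {S : Set ι} {u : ι → ℤ} (hu : ∀ i ∉ S, u i = 0) :
    1 - shift u ∈ differenceIdeal S := by
  let A : AddSubgroup (ι → ℤ) :=
    { carrier := {u | 1 - shift u ∈ differenceIdeal S}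
      add_mem' := fun {u w} h₁ h₂ => by
        change 1 - shift (u + w) ∈ differenceIdeal S
        have : (1 : ShiftRing ι) - shift (u + w) = (1 - shift u) + shift u * (1 - shift w) := by
          rw [shift_add]; ring
        rw [this]
        exact add_mem h₁ (Ideal.mul_mem_left _ _ h₂)
      zero_mem' := by
        change 1 - shift 0 ∈ differenceIdeal S
        simp [shift_zero]
      neg_mem' := fun {u} h => by
        change 1 - shift (-u) ∈ differenceIdeal S
        have h1 : shift (-u) * shift u = (1 : ShiftRing ι) := by
          rw [← shift_add, neg_add_cancel, shift_zero]
        have : (1 : ShiftRing ι) - shift (-u) = -shift (-u) * (1 - shift u) := by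
          linear_combination -h1
        rw [this]
        exact Ideal.mul_mem_left _ _ h }
  have hA : ∀ i ∈ S, (Pi.single i 1 : ι → ℤ) ∈ A := fun i hi => by
    rw [← neg_mem_iff]
    change 1 - shift (-Pi.single i 1) ∈ differenceIdeal S
    rw [← difference_X]
    exact Ideal.subset_span ⟨i, hi, rfl⟩
  have hsum : u = ∑ i, u i • (Pi.single i 1 : ι → ℤ) := by
    ext j
    simp [Finset.sum_apply, Pi.single_apply]
  change u ∈ A
  rw [hsum]
  refine sum_mem fun i _ => ?_
  by_cases hi : i ∈ S
  · exact A.zsmul_mem (hA i hi) _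
  · rw [hu i hi, zero_smul]
    exact A.zero_mem

/-- To first order, a shift is a linear combination of differences. -/
theorem one_sub_shift_sub_mem (u : ι → ℤ) :
    1 - shift (-u) - difference (linearForm fun i => (u i : ℝ)) ∈
      differenceIdeal (Set.univ : Set ι) ^ 2 := by
  have hlin : ∀ u w : ι → ℤ, difference (linearForm fun i => ((u + w) i : ℝ)) =
      difference (linearForm fun i => (u i : ℝ)) + difference (linearForm fun i => (w i : ℝ)) := by
    intro u w
    rw [← map_add, linearForm, linearForm, linearForm, ← Finset.sum_add_distrib]
    simp [add_mul]
  have hmul : ∀ u w : ι → ℤ, (1 - shift u) * (1 - shift w) ∈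
      differenceIdeal (Set.univ : Set ι) ^ 2 := fun u w => by
    rw [pow_two]
    exact Ideal.mul_mem_mul (one_sub_shift_mem (by simp)) (one_sub_shift_mem (by simp))
  have hzero : difference (linearForm fun i => (((0 : ι → ℤ) i : ℤ) : ℝ)) = 0 := by
    simp [linearForm]
  let A : AddSubgroup (ι → ℤ) :=
    { carrier := {u | 1 - shift (-u) - difference (linearForm fun i => (u i : ℝ)) ∈
        differenceIdeal (Set.univ : Set ι) ^ 2}
      add_mem' := fun {u w} h₁ h₂ => by
        change 1 - shift (-(u + w)) - difference (linearForm fun i => ((u + w) i : ℝ)) ∈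
          differenceIdeal (Set.univ : Set ι) ^ 2
        have := sub_mem (add_mem h₁ h₂) (hmul (-u) (-w))
        rw [hlin, neg_add, shift_add]
        convert this using 1
        ring
      zero_mem' := by
        change 1 - shift (-0) - difference (linearForm fun i => (((0 : ι → ℤ) i : ℤ) : ℝ)) ∈
          differenceIdeal (Set.univ : Set ι) ^ 2
        rw [hzero, neg_zero, shift_zero]
        simp
      neg_mem' := fun {u} h => by
        change 1 - shift (- -u) - difference (linearForm fun i => ((-u) i : ℝ)) ∈
          differenceIdeal (Set.univ : Set ι) ^ 2
        have h1 : shift (-u) * shift u = (1 : ShiftRing ι) := by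
          rw [← shift_add, neg_add_cancel, shift_zero]
        have h2 := hlin (-u) u
        rw [neg_add_cancel, hzero] at h2
        have := sub_mem (hmul u (-u)) h
        rw [neg_neg]
        convert this using 1
        linear_combination h2 - h1 }
  have hA : ∀ i, (Pi.single i 1 : ι → ℤ) ∈ A := fun i => by
    change 1 - shift (-Pi.single i 1) -
      difference (linearForm fun j => (((Pi.single i 1 : ι → ℤ) j : ℤ) : ℝ)) ∈
          differenceIdeal (Set.univ : Set ι) ^ 2
    have : (linearForm fun j => (((Pi.single i 1 : ι → ℤ) j : ℤ) : ℝ)) = X i := by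
      rw [linearForm, Finset.sum_eq_single i]
      · simp
      · intro j _ hj
        simp [hj]
      · simp
    rw [this, difference_X, sub_self]
    exact zero_mem _
  have hsum : u = ∑ i, u i • (Pi.single i 1 : ι → ℤ) := by
    ext j
    simp [Finset.sum_apply, Pi.single_apply]
  change u ∈ A
  rw [hsum]
  exact sum_mem fun i _ => A.zsmul_mem (hA i) _

theorem difference_mem_pow {Q : MvPolynomial ι ℝ} {m : ℕ} (hQ : Q.IsHomogeneous m) :
    difference Q ∈ differenceIdeal (Set.univ : Set ι) ^ m := by
  have h1 : Q ∈ idealOfVars ι ℝ ^ m := by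
    rw [mem_pow_idealOfVars_iff]
    intro x hx
    have := hQ (mem_support_iff.1 hx)
    exact ((DFunLike.congr_fun (Finsupp.degree_eq_weight_one (R := ℕ)) x).trans this).ge
  have h2 := Ideal.mem_map_of_mem difference h1
  rw [Ideal.map_pow, idealOfVars, Ideal.map_span] at h2
  rw [differenceIdeal, Set.image_univ]
  rwa [← Set.range_comp] at h2

/-- Straightening: products of more than `n` differences are killed if the products for nonfaces are
killed and the differences of facets through a vertex can be expressed by the others. -/
theorem differenceIdeal_pow_le {𝔞 : Ideal (ShiftRing ι)} {n : ℕ} {I : V → Finset ι}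
    (hcard : ∀ v, (I v).card = n)
    (hface : ∀ K, (∀ v, ¬ K ⊆ I v) → difference (faceMonomial K) ∈ 𝔞)
    (hrel : ∀ v, ∀ i ∈ I v, difference (X i) ∈ 𝔞 ⊔ differenceIdeal {j | j ∉ I v}) :
    differenceIdeal (Set.univ : Set ι) ^ (n + 1) ≤ 𝔞 := by
  -- K collects distinct facets while m counts the remaining difference factors. Once K has more
  -- than n elements it is a nonface.
  have key : ∀ (m : ℕ) (K : Finset ι), n + 1 ≤ K.card + m →
      ∀ q ∈ differenceIdeal (Set.univ : Set ι) ^ m, difference (faceMonomial K) * q ∈ 𝔞 := by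
    intro m
    induction m with
    | zero =>
      intro K hK q _
      refine Ideal.mul_mem_right _ _ (hface K fun v hv => ?_)
      have := Finset.card_le_card hv
      rw [hcard] at this
      omega
    | succ m ih =>
      intro K hK q hq
      by_cases hf : ∃ v, K ⊆ I v
      swap
      · exact Ideal.mul_mem_right _ _ (hface K (not_exists.1 hf))
      obtain ⟨v, hv⟩ := hf
      rw [pow_succ] at hq
      refine Submodule.mul_induction_on hq (fun b hb a ha => ?_) fun x y hx hy => ?_
      swap
      · rw [mul_add]
        exact add_mem hx hy
      -- The ideal of the last factors that bring the product into 𝔞. By induction it contains the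
      -- differences outside K; for i ∈ K the relation at v ⊇ K expresses the difference by facets
      -- missing v, which are outside K.
      let 𝔠 : Ideal (ShiftRing ι) :=
        Submodule.comap (LinearMap.mulLeft (ShiftRing ι) (difference (faceMonomial K) * b)) 𝔞
      have h𝔞 : 𝔞 ≤ 𝔠 := fun x hx => Ideal.mul_mem_left _ _ hx
      have hnot : ∀ i ∉ K, difference (X i) ∈ 𝔠 := fun i hi => by
        change difference (faceMonomial K) * b * difference (X i) ∈ 𝔞
        have := ih (insert i K) (by rw [Finset.card_insert_of_notMem hi]; omega) b hb
        rw [faceMonomial_insert hi, map_mul] at this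
        convert this using 1
        ring
      have hle : differenceIdeal (Set.univ : Set ι) ≤ 𝔠 := by
        refine Ideal.span_le.2 ?_
        rintro _ ⟨i, _, rfl⟩
        by_cases hi : i ∈ K
        · refine sup_le h𝔞 (Ideal.span_le.2 ?_) (hrel v i (hv hi))
          rintro _ ⟨j, hj, rfl⟩
          exact hnot j fun hjK => hj (hv hjK)
        · exact hnot i hi
      have := hle ha
      rwa [← mul_assoc]
  intro q hq
  simpa [faceMonomial] using key (n + 1) ∅ (by simp) q hq

/-- The action of polynomials in the differences. -/
noncomputable def differenceOp (T : Multiplicative (ι → ℤ) →* Module.End ℝ k) :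
    MvPolynomial ι ℝ →ₐ[ℝ] Module.End ℝ k :=
  (AddMonoidAlgebra.lift ℝ (Module.End ℝ k) (ι → ℤ) T).comp difference

theorem lift_shift (T : Multiplicative (ι → ℤ) →* Module.End ℝ k) (u : ι → ℤ) :
    AddMonoidAlgebra.lift ℝ (Module.End ℝ k) (ι → ℤ) T (shift u) = T (.ofAdd u) := by
  rw [shift, AddMonoidAlgebra.lift_single, one_smul]

theorem differenceOp_X (T : Multiplicative (ι → ℤ) →* Module.End ℝ k) (i : ι) :
    differenceOp T (X i) = 1 - T (.ofAdd (-Pi.single i 1)) := by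
  rw [differenceOp, AlgHom.comp_apply, difference_X, map_sub, map_one, lift_shift]

/-- The properties of the germ `vol` of the volume as a function of the support constants and of the
size `ε` of the shifts: `L` is a linear function of the support constants such that `L * vol` has the
same local behaviour as the volume. -/
structure IsVolumeGerm (D : MorseData ι V) (n : ℕ) (γ : ι → ℝ)
    (T : Multiplicative (ι → ℤ) →* Module.End ℝ k) (ε L vol : k) : Prop where
  card_eq : ∀ v, (D.I v).card = n
  isUnit : IsUnit ε
  shift_mul : ∀ u a b, T u (a * b) = T u a * T u b
  shift_step : ∀ u, T u ε = ε
  shift_linear : ∀ u : ι → ℤ, T (.ofAdd u) L = L + (∑ i, u i * γ i) • ε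
  relation : ∀ v, ∀ i ∈ D.I v, ∃ c : ι → ℤ, (∀ j, D.coeff v i j = c j) ∧ T (.ofAdd c) vol = vol
  nonface : ∀ K, (∀ v, ¬ K ⊆ D.I v) → differenceOp T (faceMonomial K) vol = 0
  nonface_mul : ∀ K, (∀ v, ¬ K ⊆ D.I v) → differenceOp T (faceMonomial K) (L * vol) = 0
  vertex : ∀ v, differenceOp T (faceMonomial (D.I v)) vol = ε ^ n

/-- The derivation which multiplies each variable by its `γ`. -/
noncomputable def eulerDerivation (γ : ι → ℝ) :
    Derivation ℝ (MvPolynomial ι ℝ) (MvPolynomial ι ℝ) :=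
  mkDerivation ℝ fun i => C (γ i) * X i

theorem sum_derivation_apply (f : ι → Derivation ℝ (MvPolynomial ι ℝ) (MvPolynomial ι ℝ))
    (s : Finset ι) (Q : MvPolynomial ι ℝ) : (∑ i ∈ s, f i) Q = ∑ i ∈ s, f i Q := by
  induction s using Finset.induction_on with
  | empty => simp
  | insert i s h ih => rw [Finset.sum_insert h, Finset.sum_insert h, Derivation.add_apply, ih]

theorem isHomogeneous_directionalDerivation (γ : ι → ℝ) {Q : MvPolynomial ι ℝ} {m : ℕ}
    (hQ : Q.IsHomogeneous m) : (directionalDerivation γ Q).IsHomogeneous (m - 1) := by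
  have : directionalDerivation γ = ∑ i : ι, (C (γ i) : MvPolynomial ι ℝ) • pderiv i := by
    refine derivation_ext fun j => ?_
    rw [directionalDerivation_X, sum_derivation_apply, Finset.sum_eq_single j]
    · simp
    · intro i _ hij
      simp [pderiv_X_of_ne hij.symm]
    · simp
  rw [this, sum_derivation_apply]
  refine IsHomogeneous.sum _ _ _ fun i _ => ?_
  have := (isHomogeneous_C ι (γ i)).mul (hQ.pderiv (i := i))
  rwa [zero_add] at this

theorem isHomogeneous_eulerDerivation (γ : ι → ℝ) {Q : MvPolynomial ι ℝ} {m : ℕ}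
    (hQ : Q.IsHomogeneous (m + 1)) : (eulerDerivation γ Q).IsHomogeneous (m + 1) := by
  have : eulerDerivation γ = ∑ i : ι, (C (γ i) * X i : MvPolynomial ι ℝ) • pderiv i := by
    refine derivation_ext fun j => ?_
    rw [eulerDerivation, mkDerivation_X, sum_derivation_apply,
      Finset.sum_eq_single j]
    · simp
    · intro i _ hij
      simp [pderiv_X_of_ne hij.symm]
    · simp
  rw [this, sum_derivation_apply]
  refine IsHomogeneous.sum _ _ _ fun i _ => ?_
  have := ((isHomogeneous_C ι (γ i)).mul (isHomogeneous_X ℝ i)).mul (hQ.pderiv (i := i))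
  rwa [zero_add, add_tsub_cancel_right, add_comm] at this

theorem isHomogeneous_faceMonomial (K : Finset ι) :
    (faceMonomial K).IsHomogeneous K.card := by
  have := IsHomogeneous.prod K (fun i => (X i : MvPolynomial ι ℝ)) (fun _ => 1)
    fun i _ => isHomogeneous_X ℝ i
  simpa [faceMonomial] using this

theorem isHomogeneous_linearForm (c : ι → ℝ) : (linearForm c).IsHomogeneous 1 :=
  IsHomogeneous.sum _ _ _ fun i _ => by
    simpa using (isHomogeneous_C ι (c i)).mul (isHomogeneous_X ℝ i)

namespace IsVolumeGerm

variable {D : MorseData ι V} {n : ℕ} {γ : ι → ℝ} {T : Multiplicative (ι → ℤ) →* Module.End ℝ k}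
  {ε L vol : k}

theorem differenceOp_step_mul (h : IsVolumeGerm D n γ T ε L vol) (Q : MvPolynomial ι ℝ) (g : k) :
    differenceOp T Q (ε * g) = ε * differenceOp T Q g := by
  induction Q using MvPolynomial.induction_on generalizing g with
  | C a =>
    rw [← algebraMap_eq, AlgHom.commutes]
    simp [Module.algebraMap_end_apply]
  | add p q hp hq => simp only [map_add, LinearMap.add_apply, hp, hq, mul_add]
  | mul_X p i hp =>
    rw [map_mul (differenceOp T), Module.End.mul_apply, Module.End.mul_apply, differenceOp_X, LinearMap.sub_apply,
      LinearMap.sub_apply, h.shift_mul, h.shift_step, Module.End.one_apply, Module.End.one_apply,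
      ← mul_sub, hp]

/-- A backward shift changes L by −γ_i ε, so ∇_i(L g) = L ∇_i g + ε γ_i (1 − ∇_i) g. The correction
is the derivation X_i ↦ γ_i (1 − X_i), a part lowering the degree by one minus a part preserving it.
-/
theorem differenceOp_linear_mul (h : IsVolumeGerm D n γ T ε L vol) (Q : MvPolynomial ι ℝ) (g : k) :
    differenceOp T Q (L * g) = L * differenceOp T Q g +
      ε * differenceOp T (directionalDerivation γ Q - eulerDerivation γ Q) g := by
  induction Q using MvPolynomial.induction_on generalizing g with
  | C a =>
    rw [← algebraMap_eq, AlgHom.commutes, Derivation.map_algebraMap, Derivation.map_algebraMap]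
    simp [Module.algebraMap_end_apply]
  | add p q hp hq =>
    simp only [map_add, map_sub, LinearMap.add_apply, LinearMap.sub_apply, hp, hq, mul_add, mul_sub]
    ring
  | mul_X p i hp =>
    have hlin : T (.ofAdd (-Pi.single i 1)) L = L - γ i • ε := by
      rw [h.shift_linear, Finset.sum_eq_single i]
      · simp [sub_eq_add_neg]
      · intro j _ hj
        simp [hj]
      · simp
    have hX : differenceOp T (X i) (L * g) =
        L * differenceOp T (X i) g + ε * differenceOp T (C (γ i) * (1 - X i)) g := by
      rw [map_mul (differenceOp T), map_sub, map_one, differenceOp_X, ← algebraMap_eq, AlgHom.commutes]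
      simp only [LinearMap.sub_apply, Module.End.mul_apply, Module.End.one_apply, h.shift_mul, hlin,
        Module.algebraMap_end_apply, sub_sub_cancel, Algebra.smul_def]
      ring
    have hd : directionalDerivation γ (p * X i) - eulerDerivation γ (p * X i) =
        (directionalDerivation γ p - eulerDerivation γ p) * X i + p * (C (γ i) * (1 - X i)) := by
      rw [Derivation.leibniz, Derivation.leibniz, directionalDerivation_X, eulerDerivation,
        mkDerivation_X]
      simp only [smul_eq_mul]
      ring
    rw [map_mul (differenceOp T), Module.End.mul_apply, hX, map_add, hp, h.differenceOp_step_mul, hd, map_add,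
      map_mul (differenceOp T) (directionalDerivation γ p - eulerDerivation γ p),
      map_mul (differenceOp T) p, LinearMap.add_apply, Module.End.mul_apply,
      Module.End.mul_apply, Module.End.mul_apply]
    ring

/-- The ideal of the shift operators that kill the volume. -/
noncomputable def annihilator (T : Multiplicative (ι → ℤ) →* Module.End ℝ k) (vol : k) :
    Ideal (ShiftRing ι) where
  carrier := {q | AddMonoidAlgebra.lift ℝ (Module.End ℝ k) (ι → ℤ) T q vol = 0}
  add_mem' h₁ h₂ := by
    change _ = _ at h₁ h₂ ⊢
    rw [map_add, LinearMap.add_apply, h₁, h₂, add_zero]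
  zero_mem' := by
    change _ = _
    simp
  smul_mem' r q h := by
    change _ = _ at h ⊢
    rw [smul_eq_mul, map_mul, Module.End.mul_apply, h, map_zero]

theorem one_sub_shift_mem_annihilator {u : ι → ℤ} (hu : T (.ofAdd u) vol = vol) :
    1 - shift u ∈ annihilator T vol := by
  change AddMonoidAlgebra.lift ℝ (Module.End ℝ k) (ι → ℤ) T (1 - shift u) vol = 0
  rw [map_sub, map_one, lift_shift, LinearMap.sub_apply, hu, Module.End.one_apply, sub_self]

theorem one_sub_shift_neg_mem_annihilator {u : ι → ℤ} (hu : T (.ofAdd u) vol = vol) :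
    1 - shift (-u) ∈ annihilator T vol := by
  have h1 : shift (-u) * shift u = (1 : ShiftRing ι) := by
    rw [← shift_add, neg_add_cancel, shift_zero]
  have : (1 : ShiftRing ι) - shift (-u) = -shift (-u) * (1 - shift u) := by
    linear_combination -h1
  rw [this]
  exact Ideal.mul_mem_left _ _ (one_sub_shift_mem_annihilator hu)

/-- A substitute for the volume being a polynomial of degree at most n: straightening applies
because translation invariance supplies the relations at each vertex. -/
theorem differenceIdeal_pow_le_annihilator (h : IsVolumeGerm D n γ T ε L vol) :
    differenceIdeal (Set.univ : Set ι) ^ (n + 1) ≤ annihilator T vol := by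
  refine differenceIdeal_pow_le h.card_eq h.nonface fun v i hi => ?_
  obtain ⟨c, hc, hvol⟩ := h.relation v i hi
  have hci : c i = 1 := by
    have := D.coeff_self v i hi
    rw [hc] at this
    exact_mod_cast this
  have hcj : ∀ j ∈ D.I v, j ≠ i → c j = 0 := fun j hj hji => by
    have := D.coeff_of_ne v i hi j hj hji
    rw [hc] at this
    exact_mod_cast this
  -- On I(v) the vector c is the i-th unit vector, so the difference is supported on facets missing
  -- v.
  have h1 : 1 - shift (c - Pi.single i 1) ∈ differenceIdeal {j | j ∉ D.I v} := by
    refine one_sub_shift_mem fun j hj => ?_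
    have hj : j ∈ D.I v := not_not.1 hj
    by_cases hji : j = i
    · subst hji
      simp [hci]
    · simp [hcj j hj hji, hji]
  have h2 := one_sub_shift_neg_mem_annihilator hvol
  have h3 : shift (c - Pi.single i 1) * shift (-c) = shift (-Pi.single i 1) := by
    rw [← shift_add]
    congr 1
    abel
  have h4 : difference (X i) =
      shift (c - Pi.single i 1) * (1 - shift (-c)) + (1 - shift (c - Pi.single i 1)) := by
    rw [difference_X, ← h3]
    ring
  rw [h4]
  exact add_mem (Ideal.mem_sup_left (Ideal.mul_mem_left _ _ h2)) (Ideal.mem_sup_right h1)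

theorem differenceOp_eq_zero (h : IsVolumeGerm D n γ T ε L vol) {Q : MvPolynomial ι ℝ} {m : ℕ}
    (hm : n < m) (hQ : Q.IsHomogeneous m) : differenceOp T Q vol = 0 :=
  h.differenceIdeal_pow_le_annihilator
    (Ideal.pow_le_pow_right (Nat.succ_le_of_lt hm) (difference_mem_pow hQ))

/-- Translation invariance kills 1 − shift(−c), which agrees with the linear form only up to second
order. After multiplication by degree m ≥ n − 1 the error has order at least n + 1 and kills the
volume. -/
theorem differenceOp_relation (h : IsVolumeGerm D n γ T ε L vol) {v : V} {i : ι} (hi : i ∈ D.I v)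
    {Q : MvPolynomial ι ℝ} {m : ℕ} (hm : n ≤ m + 1) (hQ : Q.IsHomogeneous m) :
    differenceOp T (linearForm (D.coeff v i) * Q) vol = 0 := by
  obtain ⟨c, hc, hvol⟩ := h.relation v i hi
  have e : D.coeff v i = fun j => (c j : ℝ) := funext hc
  rw [e]
  change difference (linearForm _ * Q) ∈ annihilator T vol
  have h1 : (1 - shift (-c) - difference (linearForm fun j => (c j : ℝ))) * difference Q ∈
      annihilator T vol := by
    refine h.differenceIdeal_pow_le_annihilator ?_
    refine Ideal.pow_le_pow_right (show n + 1 ≤ 2 + m by omega) ?_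
    rw [pow_add]
    exact Ideal.mul_mem_mul (one_sub_shift_sub_mem c) (difference_mem_pow hQ)
  have h2 := Ideal.mul_mem_right (difference Q) _ (one_sub_shift_neg_mem_annihilator hvol)
  have := sub_mem h2 h1
  rw [map_mul]
  convert this using 1
  ring

/-- The normalized action of the homogeneous component of degree `n` on the volume. -/
noncomputable def functional (n : ℕ) (T : Multiplicative (ι → ℤ) →* Module.End ℝ k) (ε vol : k) :
    MvPolynomial ι ℝ →ₗ[ℝ] k :=
  LinearMap.mulLeft ℝ (Ring.inverse ε ^ n) ∘ₗ LinearMap.applyₗ vol ∘ₗ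
    (differenceOp T).toLinearMap ∘ₗ homogeneousComponent n

theorem functional_apply (Q : MvPolynomial ι ℝ) : functional n T ε vol Q =
    Ring.inverse ε ^ n * differenceOp T (homogeneousComponent n Q) vol := rfl

theorem functional_of_ne {Q : MvPolynomial ι ℝ} {m : ℕ} (hQ : Q.IsHomogeneous m) (hm : n ≠ m) :
    functional n T ε vol Q = 0 := by
  rw [functional_apply, homogeneousComponent_of_mem hQ, if_neg hm]
  simp

theorem functional_eq {Q : MvPolynomial ι ℝ} (hQ : Q.IsHomogeneous n) :
    functional n T ε vol Q = Ring.inverse ε ^ n * differenceOp T Q vol := by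
  rw [functional_apply, homogeneousComponent_of_mem hQ, if_pos rfl]

theorem linearMap_eq_zero {M : Type*} [AddCommGroup M] [Module ℝ M]
    {f : MvPolynomial ι ℝ →ₗ[ℝ] M} (hf : ∀ m Q, Q.IsHomogeneous m → f Q = 0)
    (Q : MvPolynomial ι ℝ) : f Q = 0 := by
  rw [← sum_homogeneousComponent Q, map_sum]
  exact Finset.sum_eq_zero fun m _ => hf m _ (homogeneousComponent_isHomogeneous m Q)

theorem isVolumeFunctional (h : IsVolumeGerm D n γ T ε L vol) :
    IsVolumeFunctional D γ (functional n T ε vol) where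
  nonface K hK := by
    refine linearMap_eq_zero (f := functional n T ε vol ∘ₗ LinearMap.mulLeft ℝ (faceMonomial K))
      fun m Q hQ => ?_
    change functional n T ε vol (faceMonomial K * Q) = 0
    have hom := (isHomogeneous_faceMonomial K).mul hQ
    by_cases hm : n = K.card + m
    · rw [← hm] at hom
      rw [functional_eq hom, mul_comm (faceMonomial K), map_mul (differenceOp T), Module.End.mul_apply,
        h.nonface K hK, map_zero, mul_zero]
    · exact functional_of_ne hom hm
  derivation_nonface K hK := by
    refine linearMap_eq_zero (f := functional n T ε vol ∘ₗ
      (directionalDerivation γ).toLinearMap ∘ₗ LinearMap.mulLeft ℝ (faceMonomial K))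
      fun m Q hQ => ?_
    change functional n T ε vol (directionalDerivation γ (faceMonomial K * Q)) = 0
    have hom := (isHomogeneous_faceMonomial K).mul hQ
    have hom' := isHomogeneous_directionalDerivation γ hom
    -- In degree n + 1 the operator and its Euler derivative both kill vol, and the nonface kills L
    -- · vol; the Leibniz formula leaves only ε times the directional derivative, and ε is a unit.
    by_cases hm : K.card + m = n + 1
    · rw [hm] at hom hom'
      have h1 := h.differenceOp_linear_mul (faceMonomial K * Q) vol
      rw [h.differenceOp_eq_zero n.lt_succ_self hom, map_sub, LinearMap.sub_apply,
        h.differenceOp_eq_zero n.lt_succ_self (isHomogeneous_eulerDerivation γ hom),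
        mul_comm (faceMonomial K), map_mul (differenceOp T), Module.End.mul_apply, h.nonface_mul K hK, map_zero,
        mul_zero, zero_add, sub_zero] at h1
      rw [Nat.add_sub_cancel] at hom'
      rw [functional_eq hom', mul_comm (faceMonomial K), (h.isUnit.mul_right_eq_zero).1 h1.symm,
        mul_zero]
    -- Degree zero is separate: truncated subtraction gives the derivative degree 0, which may equal
    -- n, but the derivative of a constant vanishes.
    · by_cases h0 : K.card + m = 0
      · rw [h0] at hom
        obtain ⟨a, ha⟩ : ∃ a, faceMonomial K * Q = C a :=
          ⟨_, (totalDegree_eq_zero_iff_eq_C.1 (Nat.le_zero.1 hom.totalDegree_le))⟩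
        rw [ha, ← algebraMap_eq, Derivation.map_algebraMap, map_zero]
      · exact functional_of_ne hom' (by omega)
  relation v i hi := by
    refine linearMap_eq_zero
      (f := functional n T ε vol ∘ₗ LinearMap.mulLeft ℝ (linearForm (D.coeff v i)))
      fun m Q hQ => ?_
    change functional n T ε vol (linearForm (D.coeff v i) * Q) = 0
    have hom := (isHomogeneous_linearForm (D.coeff v i)).mul hQ
    by_cases hm : n = 1 + m
    · rw [← hm] at hom
      rw [functional_eq hom, h.differenceOp_relation hi (by omega) hQ, mul_zero]
    · exact functional_of_ne hom hm
  vertex v := by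
    have hom := isHomogeneous_faceMonomial (D.I v)
    rw [h.card_eq] at hom
    rw [functional_eq hom, h.vertex, ← mul_pow, Ring.inverse_mul_cancel _ h.isUnit, one_pow]
  mul_vertex v i := by
    have hom := (isHomogeneous_X ℝ i).mul (isHomogeneous_faceMonomial (D.I v))
    rw [h.card_eq] at hom
    exact functional_of_ne hom (by omega)

end IsVolumeGerm

end Shift

end MassLinear

namespace MassLinear

/-! ### Vertices, edges and a generic linear functional on a smooth polytope. -/

section Geometry

variable {n N : ℕ} {η : Fin N → Fin n → ℤ} {κ : Fin N → ℝ}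

open Classical in
/-- The facets through a point. -/
noncomputable def activeSet (η : Fin N → Fin n → ℤ) (κ : Fin N → ℝ) (x : Fin n → ℝ) :
    Finset (Fin N) := {i | toReal (η i) ⬝ᵥ x = κ i}

theorem mem_activeSet {x : Fin n → ℝ} {i : Fin N} :
    i ∈ activeSet η κ x ↔ toReal (η i) ⬝ᵥ x = κ i := by
  simp [activeSet]

theorem mem_face {I : Finset (Fin N)} {x : Fin n → ℝ} :
    x ∈ face η κ I ↔ x ∈ polytope η κ ∧ I ⊆ activeSet η κ x := by
  refine and_congr_right fun hx => forall₂_congr fun i _ => ?_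
  rw [mem_activeSet]
  exact ⟨fun h => h.2, fun h => ⟨hx, h⟩⟩

theorem continuous_dotProduct_left (a : Fin n → ℝ) : Continuous fun x : Fin n → ℝ => a ⬝ᵥ x := by
  unfold dotProduct
  fun_prop

theorem isClosed_polytope (η : Fin N → Fin n → ℤ) (κ : Fin N → ℝ) : IsClosed (polytope η κ) := by
  simp only [polytope, Set.ofPred_forall]
  exact isClosed_iInter fun i => isClosed_le (continuous_dotProduct_left _) continuous_const

theorem isClosed_face (η : Fin N → Fin n → ℤ) (κ : Fin N → ℝ) (I : Finset (Fin N)) :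
    IsClosed (face η κ I) := by
  have : face η κ I = polytope η κ ∩ ⋂ i ∈ I, {x | toReal (η i) ⬝ᵥ x = κ i} := by
    ext x
    simp [mem_face, Finset.subset_iff, mem_activeSet]
  rw [this]
  exact (isClosed_polytope η κ).inter (isClosed_biInter fun i _ =>
    isClosed_eq (continuous_dotProduct_left _) continuous_const)

theorem isExtreme_face (η : Fin N → Fin n → ℤ) (κ : Fin N → ℝ) (I : Finset (Fin N)) :
    IsExtreme ℝ (polytope η κ) (face η κ I) := by
  refine ⟨fun x hx => hx.1, fun a ha b hb x hx hxab => ?_⟩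
  obtain ⟨s, t, hs, ht, hst, rfl⟩ := hxab
  refine mem_face.2 ⟨ha, fun i hi => mem_activeSet.2 ?_⟩
  have h1 := mem_activeSet.1 ((mem_face.1 hx).2 hi)
  rw [dotProduct_add, dotProduct_smul, dotProduct_smul, smul_eq_mul, smul_eq_mul] at h1
  have h2 := ha i
  have h3 := hb i
  have ht' : t = 1 - s := by linarith
  subst ht'
  refine le_antisymm h2 ?_
  by_contra! hlt
  nlinarith

/-- A vertex in a polytope is recognized by its active conormals. -/
theorem mem_extremePoints_of_forall {x : Fin n → ℝ} (hx : x ∈ polytope η κ)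
    (h : ∀ y, (∀ i ∈ activeSet η κ x, toReal (η i) ⬝ᵥ y = 0) → y = 0) :
    x ∈ (polytope η κ).extremePoints ℝ := by
  refine ⟨hx, fun a ha b hb hab => ?_⟩
  have h1 := (isExtreme_face η κ (activeSet η κ x)).2 ha hb (mem_face.2 ⟨hx, subset_rfl⟩) hab
  refine sub_eq_zero.1 (h _ fun i hi => ?_)
  rw [dotProduct_sub, mem_activeSet.1 ((mem_face.1 h1).2 hi), mem_activeSet.1 hi, sub_self]

/-- From a point of the polytope one can move into each direction that respects the active
inequalities. -/
theorem exists_add_smul_mem_polytope {x d : Fin n → ℝ} (hx : x ∈ polytope η κ)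
    (hd : ∀ i ∈ activeSet η κ x, toReal (η i) ⬝ᵥ d ≤ 0) :
    ∃ t > (0 : ℝ), x + t • d ∈ polytope η κ := by
  have h : ∀ᶠ t in nhdsWithin (0 : ℝ) (Set.Ioi 0), ∀ i, toReal (η i) ⬝ᵥ (x + t • d) ≤ κ i := by
    rw [Filter.eventually_all]
    intro i
    by_cases hi : i ∈ activeSet η κ x
    · filter_upwards [self_mem_nhdsWithin] with t ht
      rw [dotProduct_add, dotProduct_smul, mem_activeSet.1 hi, smul_eq_mul]
      have := mul_nonpos_of_nonneg_of_nonpos (le_of_lt (Set.mem_Ioi.1 ht)) (hd i hi)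
      linarith
    · have hlt : toReal (η i) ⬝ᵥ (x + (0 : ℝ) • d) < κ i := by
        rw [zero_smul, add_zero]
        exact lt_of_le_of_ne (hx i) fun e => hi (mem_activeSet.2 e)
      have hc : Continuous fun t : ℝ => toReal (η i) ⬝ᵥ (x + t • d) :=
        (continuous_dotProduct_left _).comp (by fun_prop)
      exact ((hc.tendsto 0).eventually_lt_const hlt).filter_mono nhdsWithin_le_nhds |>.mono
        fun t ht => ht.le
  obtain ⟨t, ht, ht0⟩ := (h.and self_mem_nhdsWithin).exists
  exact ⟨t, ht0, ht⟩

/-- The vectors `e i` with `i ∈ I` form the basis of `ℤⁿ` that is dual to the conormals. -/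
structure IsDualFamily (η : Fin N → Fin n → ℤ) (I : Finset (Fin N)) (e : Fin N → Fin n → ℤ) :
    Prop where
  pairing_self : ∀ i ∈ I, η i ⬝ᵥ e i = 1
  pairing_ne : ∀ i ∈ I, ∀ j ∈ I, j ≠ i → η j ⬝ᵥ e i = 0
  expansion : ∀ x : Fin n → ℝ, x = ∑ i ∈ I, (toReal (η i) ⬝ᵥ x) • toReal (e i)

theorem toReal_dotProduct (a b : Fin n → ℤ) : toReal a ⬝ᵥ toReal b = ((a ⬝ᵥ b : ℤ) : ℝ) := by
  simp [toReal, dotProduct]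

theorem IsDualFamily.isPrimitive {I : Finset (Fin N)} {e : Fin N → Fin n → ℤ}
    (he : IsDualFamily η I e) {i : Fin N} (hi : i ∈ I) : IsPrimitive (e i) := by
  intro d hd
  have : d ∣ η i ⬝ᵥ e i := Finset.dvd_sum fun k _ => (hd k).mul_left _
  rw [he.pairing_self i hi] at this
  exact isUnit_of_dvd_one this

theorem IsDualFamily.eq_zero {I : Finset (Fin N)} {e : Fin N → Fin n → ℤ}
    (he : IsDualFamily η I e) {x : Fin n → ℝ} (hx : ∀ i ∈ I, toReal (η i) ⬝ᵥ x = 0) : x = 0 := by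
  rw [he.expansion x]
  exact Finset.sum_eq_zero fun i hi => by rw [hx i hi, zero_smul]

namespace IsSmoothPolytope

theorem exists_basis (hΔ : IsSmoothPolytope η κ) {v : Fin n → ℝ}
    (hv : v ∈ (polytope η κ).extremePoints ℝ) :
    ∃ b : Module.Basis {i // i ∈ activeSet η κ v} ℤ (Fin n → ℤ), ∀ i, b i = η i := by
  have hmem : ∀ i, v ∈ facet η κ i ↔ i ∈ activeSet η κ v := fun i => by
    rw [mem_activeSet]
    exact ⟨fun h => h.2, fun h => ⟨hv.1, h⟩⟩
  let b := Module.Basis.mk (hΔ.linearIndependent v hv) (hΔ.span_eq_top v hv).ge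
  refine ⟨b.reindex (Equiv.subtypeEquivRight hmem), fun i => ?_⟩
  simp [b]

theorem card_activeSet (hΔ : IsSmoothPolytope η κ) {v : Fin n → ℝ}
    (hv : v ∈ (polytope η κ).extremePoints ℝ) : (activeSet η κ v).card = n := by
  obtain ⟨b, _⟩ := hΔ.exists_basis hv
  have := Module.finrank_eq_card_basis b
  simpa using this.symm

theorem exists_isDualFamily (hΔ : IsSmoothPolytope η κ) {v : Fin n → ℝ}
    (hv : v ∈ (polytope η κ).extremePoints ℝ) : ∃ e, IsDualFamily η (activeSet η κ v) e := by
  classical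
  obtain ⟨b, hb⟩ := hΔ.exists_basis hv
  let e : Fin N → Fin n → ℤ := fun i k =>
    if hi : i ∈ activeSet η κ v then b.coord ⟨i, hi⟩ (Pi.single k 1) else 0
  have he : ∀ i (hi : i ∈ activeSet η κ v) (a : Fin n → ℤ), a ⬝ᵥ e i = b.coord ⟨i, hi⟩ a := by
    intro i hi a
    conv_rhs => rw [← Finset.univ_sum_single a]
    rw [map_sum, dotProduct]
    refine Finset.sum_congr rfl fun k _ => ?_
    have : (Pi.single k (a k) : Fin n → ℤ) = a k • Pi.single k 1 := by
      rw [← Pi.single_smul, smul_eq_mul, mul_one]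
    rw [this, map_smul, smul_eq_mul]
    simp only [e, dif_pos hi]
  refine ⟨e, ⟨fun i hi => ?_, fun i hi j hj hji => ?_, fun x => ?_⟩⟩
  · rw [he i hi]
    have := b.repr_self ⟨i, hi⟩
    rw [hb] at this
    simp [Module.Basis.coord_apply, this]
  · rw [he i hi]
    have := b.repr_self ⟨j, hj⟩
    rw [hb] at this
    simp [Module.Basis.coord_apply, this, hji]
  · have hsum : ∀ k l, ∑ i ∈ activeSet η κ v, e i k * η i l =
        (Pi.single k 1 : Fin n → ℤ) l := fun k l => by
      have := congrFun (b.sum_repr (Pi.single k 1)) l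
      rw [Finset.sum_apply] at this
      rw [← this, ← Finset.sum_coe_sort]
      refine Finset.sum_congr rfl fun i _ => ?_
      simp only [e, dif_pos i.2, Pi.smul_apply, hb, smul_eq_mul, Module.Basis.coord_apply]
    ext k
    simp only [Finset.sum_apply, Pi.smul_apply, smul_eq_mul, dotProduct, Finset.sum_mul, toReal]
    rw [Finset.sum_comm]
    have : ∀ l, ∑ i ∈ activeSet η κ v, (η i l : ℝ) * x l * (e i k : ℝ) =
        ((Pi.single k 1 : Fin n → ℤ) l : ℝ) * x l := fun l => by
      rw [← hsum k l]
      push_cast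
      rw [Finset.sum_mul]
      exact Finset.sum_congr rfl fun i _ => by ring
    simp only [this]
    rw [Finset.sum_eq_single k]
    · simp
    · intro l _ hl
      simp [hl]
    · simp

theorem eq_of_activeSet_subset (hΔ : IsSmoothPolytope η κ) {v w : Fin n → ℝ}
    (hv : v ∈ (polytope η κ).extremePoints ℝ) (h : activeSet η κ v ⊆ activeSet η κ w) : v = w := by
  obtain ⟨e, he⟩ := hΔ.exists_isDualFamily hv
  refine sub_eq_zero.1 (he.eq_zero fun i hi => ?_)
  rw [dotProduct_sub, mem_activeSet.1 hi, mem_activeSet.1 (h hi), sub_self]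

theorem finite_extremePoints (hΔ : IsSmoothPolytope η κ) :
    ((polytope η κ).extremePoints ℝ).Finite := by
  refine Set.Finite.of_finite_image (f := activeSet η κ) (Set.toFinite _) ?_
  exact fun v hv w _ hvw => hΔ.eq_of_activeSet_subset hv (hvw ▸ subset_rfl)

theorem isCompact (hΔ : IsSmoothPolytope η κ) : IsCompact (polytope η κ) :=
  Metric.isCompact_of_isClosed_isBounded (isClosed_polytope η κ) hΔ.isBounded

/-- On each face a linear functional is minimal at a vertex. -/
theorem exists_lowest_vertex (hΔ : IsSmoothPolytope η κ) (ρ : (Fin n → ℝ) →ₗ[ℝ] ℝ)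
    {I : Finset (Fin N)} (hI : (face η κ I).Nonempty) :
    ∃ v ∈ (polytope η κ).extremePoints ℝ, v ∈ face η κ I ∧ ∀ x ∈ face η κ I, ρ v ≤ ρ x := by
  have hc : IsCompact (face η κ I) := hΔ.isCompact.of_isClosed_subset (isClosed_face η κ I)
    fun x hx => hx.1
  have hρ : Continuous ρ := ρ.continuous_of_finiteDimensional
  obtain ⟨x₀, hx₀, hmin⟩ := hc.exists_isMinOn hI hρ.continuousOn
  have hmin' : ∀ x ∈ face η κ I, ρ x₀ ≤ ρ x := fun x hx => hmin hx
  -- The minimizers form an extreme subset, so its extreme points are vertices of the polytope.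
  have hB : IsExtreme ℝ (face η κ I) {x ∈ face η κ I | ρ x = ρ x₀} := by
    refine ⟨fun x hx => hx.1, fun a ha b hb x hx hxab => ⟨ha, ?_⟩⟩
    obtain ⟨s, t, hs, ht, hst, rfl⟩ := hxab
    have h1 := hx.2
    rw [map_add, map_smul, map_smul, smul_eq_mul, smul_eq_mul] at h1
    have h2 := hmin' a ha
    have h3 := hmin' b hb
    have ht' : t = 1 - s := by linarith
    subst ht'
    refine le_antisymm ?_ h2
    by_contra! hlt
    nlinarith
  have hBc : IsCompact {x ∈ face η κ I | ρ x = ρ x₀} :=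
    hc.inter_right (isClosed_eq hρ continuous_const)
  obtain ⟨v, hv⟩ := hBc.extremePoints_nonempty ⟨x₀, hx₀, rfl⟩
  refine ⟨v, ((isExtreme_face η κ I).trans hB).extremePoints_subset_extremePoints hv, hv.1.1, ?_⟩
  intro x hx
  rw [hv.1.2]
  exact hmin' x hx

theorem face_nonempty_iff (hΔ : IsSmoothPolytope η κ) {I : Finset (Fin N)} :
    (face η κ I).Nonempty ↔ ∃ v ∈ (polytope η κ).extremePoints ℝ, I ⊆ activeSet η κ v := by
  constructor
  · intro hI
    obtain ⟨v, hv, hvI, -⟩ := hΔ.exists_lowest_vertex 0 hI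
    exact ⟨v, hv, (mem_face.1 hvI).2⟩
  · rintro ⟨v, hv, hI⟩
    exact ⟨v, mem_face.2 ⟨hv.1, hI⟩⟩

/-- A linear functional in general position with respect to the vertices. -/
theorem exists_generic (hΔ : IsSmoothPolytope η κ) :
    ∃ ρ : (Fin n → ℝ) →ₗ[ℝ] ℝ,
      Function.Injective fun v : (polytope η κ).extremePoints ℝ => ρ v := by
  have := hΔ.finite_extremePoints.to_subtype
  set E := (polytope η κ).extremePoints ℝ with hE
  obtain ⟨ρ, hρ⟩ := Module.exists_dual_forall_apply_ne_zero (K := ℝ)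
    (fun p : {p : E × E // p.1 ≠ p.2} => (p.1.1 : Fin n → ℝ) - p.1.2)
    fun p h => p.2 (Subtype.ext (sub_eq_zero.1 h))
  refine ⟨ρ, fun v w hvw => ?_⟩
  by_contra hne
  refine hρ ⟨(v, w), hne⟩ ?_
  change ρ (v - w) = 0
  rw [map_sub, sub_eq_zero]
  exact hvw

open Classical in
/-- The combinatorial data of a smooth polytope. -/
theorem exists_morseData (hΔ : IsSmoothPolytope η κ)
    (e : (polytope η κ).extremePoints ℝ → Fin N → Fin n → ℤ)
    (he : ∀ v : (polytope η κ).extremePoints ℝ, IsDualFamily η (activeSet η κ v) (e v)) :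
    ∃ D : MorseData (Fin N) ((polytope η κ).extremePoints ℝ),
      (∀ v, D.I v = activeSet η κ v) ∧
        ∀ v i j, D.coeff v i j = ((η j ⬝ᵥ e v i : ℤ) : ℝ) := by
  obtain ⟨ρ, hinj⟩ := hΔ.exists_generic
  -- The slacks κ_i − ⟨η_i, x⟩ of the facets through v are nonnegative coordinates centred at v, so
  -- the signs of ρ(e_i) decide how ρ x compares with ρ v.
  have hdiff : ∀ v x : (polytope η κ).extremePoints ℝ, ρ (x : Fin n → ℝ) - ρ (v : Fin n → ℝ) =
      ∑ i ∈ activeSet η κ v,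
        (κ i - toReal (η i) ⬝ᵥ (x : Fin n → ℝ)) * -ρ (toReal (e v i)) := by
    intro v x
    rw [← map_sub, (he v).expansion (x - v), map_sum]
    refine Finset.sum_congr rfl fun i hi => ?_
    rw [map_smul, dotProduct_sub, mem_activeSet.1 hi, smul_eq_mul]
    ring
  refine ⟨{
    I := fun v => activeSet η κ v
    -- The edge leaving F_i at v points along −e_i, so J(v) lists the facets whose leaving edge
    -- descends.
    J := fun v => {i ∈ activeSet η κ v | 0 < ρ (toReal (e v i))}
    height := fun v => ρ v
    coeff := fun v i j => ((η j ⬝ᵥ e v i : ℤ) : ℝ)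
    height_injective := hinj
    J_subset := fun v => Finset.filter_subset _ _
    le_of_J_subset := ?_
    le_of_sdiff_subset := ?_
    exists_lowest := ?_
    coeff_self := fun v i hi => by simp [(he v).pairing_self i hi]
    coeff_of_ne := fun v i hi j hj hji => by simp [(he v).pairing_ne i hi j hj hji] },
    fun _ => rfl, fun _ _ _ => rfl⟩
  · intro v u h
    rw [← sub_nonneg, hdiff]
    refine Finset.sum_nonneg fun i hi => ?_
    by_cases hpos : 0 < ρ (toReal (e v i))
    · rw [mem_activeSet.1 (h (Finset.mem_filter.2 ⟨hi, hpos⟩)), sub_self, zero_mul]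
    · exact mul_nonneg (sub_nonneg.2 (u.2.1 i)) (by linarith)
  · intro v u h
    rw [← sub_nonpos, hdiff]
    refine Finset.sum_nonpos fun i hi => ?_
    by_cases hpos : 0 < ρ (toReal (e v i))
    · exact mul_nonpos_of_nonneg_of_nonpos (sub_nonneg.2 (u.2.1 i)) (by linarith)
    · rw [mem_activeSet.1 (h (Finset.mem_sdiff.2 ⟨hi, fun hc => hpos (Finset.mem_filter.1 hc).2⟩)),
        sub_self, zero_mul]
  · intro v K hK
    obtain ⟨u, hu, huK, hmin⟩ := hΔ.exists_lowest_vertex ρ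
      (hΔ.face_nonempty_iff.2 ⟨v, v.2, hK⟩)
    refine ⟨⟨u, hu⟩, (mem_face.1 huK).2, fun i hi => ?_⟩
    obtain ⟨hiu, hpos⟩ := Finset.mem_filter.1 hi
    by_contra hiK
    have hpair : ∀ j ∈ activeSet η κ u, j ≠ i → toReal (η j) ⬝ᵥ toReal (e ⟨u, hu⟩ i) = 0 :=
      fun j hj hji => by rw [toReal_dotProduct, (he ⟨u, hu⟩).pairing_ne i hiu j hj hji, Int.cast_zero]
    -- If i ∈ J(u) were not in K, the step along −e_i would stay in the face F_K and lower ρ below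
    -- its minimum.
    obtain ⟨t, ht, hmem⟩ := exists_add_smul_mem_polytope (d := -toReal (e ⟨u, hu⟩ i)) hu.1
      fun j hj => by
        rw [dotProduct_neg]
        by_cases hji : j = i
        · subst hji
          rw [toReal_dotProduct, (he ⟨u, hu⟩).pairing_self j hiu]
          simp
        · rw [hpair j hj hji, neg_zero]
    have hface : u + t • -toReal (e ⟨u, hu⟩ i) ∈ face η κ K := by
      refine mem_face.2 ⟨hmem, fun j hj => mem_activeSet.2 ?_⟩
      have hju := (mem_face.1 huK).2 hj
      rw [dotProduct_add, dotProduct_smul, dotProduct_neg,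
        hpair j hju (fun e => hiK (e ▸ hj)), neg_zero, smul_zero, add_zero]
      exact mem_activeSet.1 hju
    have h1 := hmin _ hface
    rw [map_add, map_smul, map_neg, smul_eq_mul] at h1
    nlinarith

/-- The edge that leaves a facet at a vertex. -/
theorem exists_edge (hΔ : IsSmoothPolytope η κ) {w : Fin n → ℝ}
    (hw : w ∈ (polytope η κ).extremePoints ℝ) {e : Fin N → Fin n → ℤ}
    (he : IsDualFamily η (activeSet η κ w) e) {j : Fin N} (hj : j ∈ activeSet η κ w) :
    ∃ (u : Fin n → ℝ) (k : Fin N), u ∈ (polytope η κ).extremePoints ℝ ∧ k ∉ activeSet η κ w ∧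
      activeSet η κ u = insert k ((activeSet η κ w).erase j) ∧
      face η κ ((activeSet η κ w).erase j) = segment ℝ u w ∧
      0 < κ k - toReal (η k) ⬝ᵥ w ∧ w - u = (κ k - toReal (η k) ⬝ᵥ w) • toReal (e j) := by
  have hself : toReal (η j) ⬝ᵥ toReal (e j) = 1 := by
    rw [toReal_dotProduct, he.pairing_self j hj, Int.cast_one]
  have hpair : ∀ i ∈ activeSet η κ w, i ≠ j → toReal (η i) ⬝ᵥ toReal (e j) = 0 :=
    fun i hi hij => by rw [toReal_dotProduct, he.pairing_ne j hj i hi hij, Int.cast_zero]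
  have hne : toReal (e j) ≠ 0 := fun h => by
    rw [h, dotProduct_zero] at hself
    exact zero_ne_one hself
  -- the points of the face
  have hface : ∀ x ∈ face η κ ((activeSet η κ w).erase j),
      x = w - (κ j - toReal (η j) ⬝ᵥ x) • toReal (e j) := by
    intro x hx
    have h1 := he.expansion (x - w)
    rw [Finset.sum_eq_single j] at h1
    · rw [dotProduct_sub, mem_activeSet.1 hj] at h1
      rw [← neg_sub (toReal (η j) ⬝ᵥ x), neg_smul, sub_neg_eq_add, ← h1, add_sub_cancel]
    · intro i hi hij
      have h2 := mem_activeSet.1 ((mem_face.1 hx).2 (Finset.mem_erase.2 ⟨hij, hi⟩))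
      rw [dotProduct_sub, h2, mem_activeSet.1 hi, sub_self, zero_smul]
    · exact fun h => absurd hj h
  let f : ℝ → Fin n → ℝ := fun s => w - s • toReal (e j)
  have hf : Continuous f := by fun_prop
  -- The parameters for which the ray from w along −e_j is still in the polytope; the maximum t
  -- gives the other endpoint u.
  let S : Set ℝ := {s | 0 ≤ s ∧ f s ∈ polytope η κ}
  have hSclosed : IsClosed S := isClosed_Ici.inter ((isClosed_polytope η κ).preimage hf)
  have hSbdd : Bornology.IsBounded S := by
    obtain ⟨R, hR⟩ := hΔ.isBounded.subset_closedBall w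
    refine (Metric.isBounded_Icc (0 : ℝ) (R / ‖toReal (e j)‖)).subset fun s hs => ⟨hs.1, ?_⟩
    have := hR hs.2
    rw [Metric.mem_closedBall, dist_eq_norm, sub_sub_cancel_left, norm_neg, norm_smul,
      Real.norm_of_nonneg hs.1] at this
    rwa [le_div_iff₀ (norm_pos_iff.2 hne)]
  have hS0 : (0 : ℝ) ∈ S := ⟨le_rfl, by simpa [f] using hw.1⟩
  obtain ⟨t, htS, htmax⟩ := (Metric.isCompact_of_isClosed_isBounded hSclosed hSbdd).exists_isMaxOn
    ⟨0, hS0⟩ continuousOn_id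
  have htmax' : ∀ s ∈ S, s ≤ t := fun s hs => htmax hs
  have htpos : 0 < t := by
    obtain ⟨s, hs, hmem⟩ := exists_add_smul_mem_polytope (d := -toReal (e j)) hw.1 fun i hi => by
      rw [dotProduct_neg]
      by_cases hij : i = j
      · subst hij
        rw [hself]
        norm_num
      · rw [hpair i hi hij, neg_zero]
    refine lt_of_lt_of_le hs (htmax' s ⟨hs.le, ?_⟩)
    simpa [f, sub_eq_add_neg] using hmem
  set u := f t with hu
  -- Without a new facet blocking the direction −e_j at u, the ray could be continued beyond t.
  obtain ⟨k, hku, hkneg⟩ : ∃ k ∈ activeSet η κ u, toReal (η k) ⬝ᵥ toReal (e j) < 0 := by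
    by_contra! hc
    obtain ⟨s, hs, hmem⟩ := exists_add_smul_mem_polytope (d := -toReal (e j)) htS.2 fun i hi => by
      rw [dotProduct_neg]
      linarith [hc i hi]
    have h1 : f (t + s) ∈ polytope η κ := by
      convert hmem using 1
      simp only [f, add_smul, smul_neg]
      abel
    linarith [htmax' (t + s) ⟨by linarith, h1⟩]
  have hkw : k ∉ activeSet η κ w := fun hk => by
    by_cases hkj : k = j
    · rw [hkj, hself] at hkneg
      linarith
    · rw [hpair k hk hkj] at hkneg
      exact lt_irrefl _ hkneg
  have hsub : insert k ((activeSet η κ w).erase j) ⊆ activeSet η κ u := by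
    refine Finset.insert_subset hku fun i hi => ?_
    obtain ⟨hij, hi⟩ := Finset.mem_erase.1 hi
    rw [mem_activeSet, hu, dotProduct_sub, dotProduct_smul, hpair i hi hij, smul_zero, sub_zero]
    exact mem_activeSet.1 hi
  have hext : u ∈ (polytope η κ).extremePoints ℝ := by
    refine mem_extremePoints_of_forall htS.2 fun y hy => ?_
    have h1 := he.expansion y
    rw [Finset.sum_eq_single j] at h1
    · have h2 := hy k hku
      rw [h1, dotProduct_smul, smul_eq_mul] at h2
      rw [h1, (mul_eq_zero.1 h2).resolve_right hkneg.ne, zero_smul]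
    · intro i hi hij
      rw [hy i (hsub (Finset.mem_insert_of_mem (Finset.mem_erase.2 ⟨hij, hi⟩))), zero_smul]
    · exact fun h => absurd hj h
  have hact : activeSet η κ u = insert k ((activeSet η κ w).erase j) := by
    refine (Finset.eq_of_subset_of_card_le hsub ?_).symm
    rw [hΔ.card_activeSet hext, Finset.card_insert_of_notMem (fun h =>
      hkw (Finset.mem_of_mem_erase h)), Finset.card_erase_add_one hj, hΔ.card_activeSet hw]
  -- Smoothness at u: e_j = ⟨η_k, e_j⟩ e'_k in the dual basis at u, and pairing with η_j writes 1 as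
  -- a product of two integers, the first of which is negative.
  have hk1 : toReal (η k) ⬝ᵥ toReal (e j) = -1 := by
    obtain ⟨e', he'⟩ := hΔ.exists_isDualFamily hext
    have h1 := he'.expansion (toReal (e j))
    rw [Finset.sum_eq_single k] at h1
    · have h2 := congrArg (fun x => toReal (η j) ⬝ᵥ x) h1
      simp only [dotProduct_smul, hself, toReal_dotProduct, smul_eq_mul] at h2
      rw [toReal_dotProduct] at hkneg ⊢
      have h3 : (1 : ℤ) = (η k ⬝ᵥ e j) * (η j ⬝ᵥ e' k) := by exact_mod_cast h2
      have h4 : η k ⬝ᵥ e j < 0 := by exact_mod_cast hkneg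
      rcases Int.isUnit_iff.1 (IsUnit.of_mul_eq_one _ h3.symm) with h5 | h5
      · omega
      · rw [h5]
        norm_num
    · intro i hi hik
      rw [hact] at hi
      obtain ⟨hij, hi⟩ := Finset.mem_erase.1 (Finset.mem_of_mem_insert_of_ne hi hik)
      rw [hpair i hi hij, zero_smul]
    · exact fun h => absurd hku h
  have ht : t = κ k - toReal (η k) ⬝ᵥ w := by
    have := mem_activeSet.1 hku
    rw [hu, dotProduct_sub, dotProduct_smul, hk1, smul_eq_mul] at this
    linarith
  refine ⟨u, k, hext, hkw, hact, ?_, ht ▸ htpos, ?_⟩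
  · ext x
    constructor
    · intro hx
      have h1 := hface x hx
      set s := κ j - toReal (η j) ⬝ᵥ x
      have hs0 : 0 ≤ s := sub_nonneg.2 (hx.1 j)
      have hst : s ≤ t := htmax' s ⟨hs0, by rw [show f s = x from h1.symm]; exact hx.1⟩
      refine ⟨s / t, 1 - s / t, by positivity, sub_nonneg.2 ((div_le_one htpos).2 hst), by ring, ?_⟩
      rw [h1, hu]
      simp only [f, smul_sub, smul_smul, div_mul_cancel₀ _ htpos.ne', sub_smul, one_smul]
      abel
    · rintro ⟨a, b, ha, hb, hab, rfl⟩
      refine mem_face.2 ⟨?_, fun i hi => mem_activeSet.2 ?_⟩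
      · intro i
        rw [dotProduct_add, dotProduct_smul, dotProduct_smul, smul_eq_mul, smul_eq_mul]
        have h1 := mul_le_mul_of_nonneg_left (hext.1 i) ha
        have h2 := mul_le_mul_of_nonneg_left (hw.1 i) hb
        have h3 : a * κ i + b * κ i = κ i := by rw [← add_mul, hab, one_mul]
        linarith
      · rw [dotProduct_add, dotProduct_smul, dotProduct_smul, smul_eq_mul, smul_eq_mul,
          mem_activeSet.1 (hsub (Finset.mem_insert_of_mem hi)),
          mem_activeSet.1 (Finset.mem_of_mem_erase hi), ← add_mul, hab, one_mul]
  · rw [← ht, hu]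
    simp [f]

end IsSmoothPolytope

end Geometry

end MassLinear

namespace MassLinear

/-! ### From the volume functional to the two identities. -/

section Edges

variable {n N : ℕ} {η : Fin N → Fin n → ℤ} {κ : Fin N → ℝ}

theorem right_mem_extremePoints_segment {v w : Fin n → ℝ} (hvw : v ≠ w) :
    w ∈ (segment ℝ v w).extremePoints ℝ := by
  have hc : IsCompact (segment ℝ v w) := by
    rw [← convexHull_pair]
    exact (Set.toFinite {v, w}).isCompact_convexHull ℝ
  have h2 : (segment ℝ v w).extremePoints ℝ ⊆ {v, w} := by
    rw [← convexHull_pair]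
    exact extremePoints_convexHull_subset
  by_contra hw
  have h3 : (segment ℝ v w).extremePoints ℝ ⊆ {v} := fun x hx => by
    rcases h2 hx with rfl | rfl
    · rfl
    · exact absurd hx hw
  have h4 : segment ℝ v w ⊆ {v} := by
    rw [← closure_convexHull_extremePoints hc (convex_segment v w)]
    exact closure_minimal (convexHull_min h3 (convex_singleton v)) isClosed_singleton
  exact hvw (h4 (right_mem_segment ℝ v w)).symm

theorem face_subset_face {I K : Finset (Fin N)} (h : I ⊆ K) : face η κ K ⊆ face η κ I :=
  fun _ hx => ⟨hx.1, fun i hi => hx.2 i (h hi)⟩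

/-- A vertex on an edge is one of its endpoints. -/
theorem eq_or_eq_of_mem_face {I : Finset (Fin N)} {u v w : Fin n → ℝ}
    (hI : face η κ I = segment ℝ v w) (hu : u ∈ (polytope η κ).extremePoints ℝ)
    (huI : u ∈ face η κ I) : u = v ∨ u = w := by
  have hv : v ∈ polytope η κ := (hI ▸ left_mem_segment ℝ v w : v ∈ face η κ I).1
  have hw : w ∈ polytope η κ := (hI ▸ right_mem_segment ℝ v w : w ∈ face η κ I).1
  rw [hI] at huI
  rcases (mem_extremePoints_iff_forall_segment.1 hu).2 v hv w hw huI with h | h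
  · exact Or.inl h.symm
  · exact Or.inr h.symm

namespace IsSmoothPolytope

/-- Directed edges correspond to pairs of an endpoint w and a facet j through w. If a facet i ≠ j
through w were missing from I, the edge leaving F_i at w would lie in F_I, and its other end would
be a vertex of the segment in F_j, distinct from w; but v is not in F_j. -/
theorem of_mem_directedEdges (hΔ : IsSmoothPolytope η κ) {v w : Fin n → ℝ} {j : Fin N}
    (h : (v, w, j) ∈ directedEdges η κ) : w ∈ (polytope η κ).extremePoints ℝ ∧
      j ∈ activeSet η κ w ∧ face η κ ((activeSet η κ w).erase j) = segment ℝ v w := by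
  obtain ⟨hvw, ⟨I, hI⟩, hw, hv⟩ := h
  simp only at hvw hI hw hv
  have hwext : w ∈ (polytope η κ).extremePoints ℝ :=
    (isExtreme_face η κ I).extremePoints_subset_extremePoints
      (hI ▸ right_mem_extremePoints_segment hvw)
  have hwI : w ∈ face η κ I := hI ▸ right_mem_segment ℝ v w
  have hvI : v ∈ face η κ I := hI ▸ left_mem_segment ℝ v w
  have hjw : j ∈ activeSet η κ w := mem_activeSet.2 hw.2
  have hjI : j ∉ I := fun hj => hv (hvI.2 j hj)
  have hIw : I ⊆ (activeSet η κ w).erase j :=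
    Finset.subset_erase.2 ⟨(mem_face.1 hwI).2, hjI⟩
  obtain ⟨e, he⟩ := hΔ.exists_isDualFamily hwext
  have heq : I = (activeSet η κ w).erase j := by
    refine Finset.Subset.antisymm hIw fun i hi => ?_
    by_contra hiI
    obtain ⟨hij, hi⟩ := Finset.mem_erase.1 hi
    obtain ⟨u, k, huext, hk, hact, hseg, -, -⟩ := hΔ.exists_edge hwext he hi
    have hu : u ∈ face η κ I := face_subset_face
      (Finset.subset_erase.2 ⟨(mem_face.1 hwI).2, hiI⟩) (hseg ▸ left_mem_segment ℝ u w)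
    rcases eq_or_eq_of_mem_face hI huext hu with rfl | rfl
    · refine hv ⟨huext.1, mem_activeSet.1 ?_⟩
      rw [hact]
      exact Finset.mem_insert_of_mem (Finset.mem_erase.2 ⟨hij.symm, hjw⟩)
    · refine hk ?_
      nth_rw 1 [hact]
      exact Finset.mem_insert_self _ _
  exact ⟨hwext, hjw, heq ▸ hI⟩

end IsSmoothPolytope

variable {k : Type*} [CommRing k] [Algebra ℝ k]

open MvPolynomial

theorem linearForm_sub (c c' : Fin N → ℝ) :
    linearForm (c - c') = linearForm c - linearForm c' := by
  simp [linearForm, sub_mul]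

theorem linearForm_mul_apply (ψ : MvPolynomial (Fin N) ℝ →ₗ[ℝ] k) (c : Fin N → ℝ)
    (Q : MvPolynomial (Fin N) ℝ) : ψ (linearForm c * Q) = ∑ i, c i • ψ (X i * Q) := by
  simp [linearForm, Finset.sum_mul, ← smul_eq_C_mul]

namespace IsVolumeFunctional

variable {D : MorseData (Fin N) ((polytope η κ).extremePoints ℝ)} {γ : Fin N → ℝ}
  {ψ : MvPolynomial (Fin N) ℝ →ₗ[ℝ] k}
  {e : (polytope η κ).extremePoints ℝ → Fin N → Fin n → ℤ}

/-- The form is the derivative along a translation by x; expanding x in the dual basis at w reduces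
it to the relations at w. -/
theorem linearForm_dotProduct (h : IsVolumeFunctional D γ ψ)
    (hI : ∀ v, D.I v = activeSet η κ v)
    (hD : ∀ v i j, D.coeff v i j = ((η j ⬝ᵥ e v i : ℤ) : ℝ))
    (he : ∀ v : (polytope η κ).extremePoints ℝ, IsDualFamily η (activeSet η κ v) (e v))
    (w : (polytope η κ).extremePoints ℝ) (x : Fin n → ℝ) (Q : MvPolynomial (Fin N) ℝ) :
    ψ (linearForm (fun i => toReal (η i) ⬝ᵥ x) * Q) = 0 := by
  have : linearForm (fun j => toReal (η j) ⬝ᵥ x) =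
      ∑ i ∈ D.I w, (toReal (η i) ⬝ᵥ x) • linearForm (D.coeff w i) := by
    simp only [linearForm, smul_eq_C_mul, Finset.mul_sum]
    rw [Finset.sum_comm]
    refine Finset.sum_congr rfl fun j _ => ?_
    simp only [← mul_assoc, ← C_mul, ← Finset.sum_mul, ← map_sum]
    congr 2
    conv_lhs => rw [(he w).expansion x]
    rw [dotProduct_sum, hI]
    refine Finset.sum_congr rfl fun i _ => ?_
    rw [dotProduct_smul, smul_eq_mul, toReal_dotProduct, hD]
  rw [this, Finset.sum_mul, map_sum]
  refine Finset.sum_eq_zero fun i hi => ?_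
  rw [smul_mul_assoc, map_smul, h.relation w i hi, smul_zero]

theorem nonface_insert (hΔ : IsSmoothPolytope η κ) (hI : ∀ v, D.I v = activeSet η κ v)
    {w : (polytope η κ).extremePoints ℝ} {i : Fin N} (hi : i ∉ activeSet η κ w) :
    ∀ v, ¬ insert i (activeSet η κ w) ⊆ D.I v := by
  intro v hv
  rw [hI] at hv
  have := hΔ.eq_of_activeSet_subset w.2 ((Finset.subset_insert _ _).trans hv)
  exact hi (this ▸ hv (Finset.mem_insert_self _ _))

/-- The pairing of a facet that misses a vertex with an edge through that vertex. -/
theorem X_mul_faceMonomial (h : IsVolumeFunctional D γ ψ)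
    (hI : ∀ v, D.I v = activeSet η κ v) {w u : Fin n → ℝ} {j k : Fin N}
    (hu : u ∈ (polytope η κ).extremePoints ℝ)
    (hact : activeSet η κ u = insert k ((activeSet η κ w).erase j))
    (hseg : face η κ ((activeSet η κ w).erase j) = segment ℝ u w) {i : Fin N}
    (hi : i ∉ activeSet η κ w) :
    ψ (X i * faceMonomial ((activeSet η κ w).erase j)) = if i = k then 1 else 0 := by
  have hi' : i ∉ (activeSet η κ w).erase j := fun h => hi (Finset.mem_of_mem_erase h)
  rw [← faceMonomial_insert hi']
  split_ifs with hik
  · subst hik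
    have := h.vertex ⟨u, hu⟩
    rwa [hI, hact] at this
  · have := h.nonface (insert i ((activeSet η κ w).erase j)) (fun v hv => ?_) 1
    · rwa [mul_one] at this
    rw [hI] at hv
    have hvf : (v : Fin n → ℝ) ∈ face η κ ((activeSet η κ w).erase j) :=
      mem_face.2 ⟨v.2.1, (Finset.subset_insert _ _).trans hv⟩
    have hiv := hv (Finset.mem_insert_self _ _)
    rcases eq_or_eq_of_mem_face hseg v.2 hvf with e | e
    · rw [e, hact, Finset.mem_insert] at hiv
      exact hiv.elim hik hi'
    · rw [e] at hiv
      exact hi hiv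

/-- For each facet i missing w, apply ψ ∘ d to the nonface I(w) ∪ {i}. In the sum over i every γ_j
with j ∈ I(w) occurs once, through the single facet missing w on which the edge leaving F_j ends. -/
theorem sum_coefficients_eq_zero [Nontrivial k] (h : IsVolumeFunctional D γ ψ)
    (hΔ : IsSmoothPolytope η κ) (hI : ∀ v, D.I v = activeSet η κ v)
    (he : ∀ v : (polytope η κ).extremePoints ℝ, IsDualFamily η (activeSet η κ v) (e v))
    (w : (polytope η κ).extremePoints ℝ) : ∑ i, γ i = 0 := by
  refine (algebraMap ℝ k).injective ?_
  rw [map_zero]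
  have h1 : ∀ i ∈ (activeSet η κ w)ᶜ, algebraMap ℝ k (γ i) + ∑ j ∈ activeSet η κ w,
      γ j • ψ (X i * faceMonomial ((activeSet η κ w).erase j)) = 0 := by
    intro i hi
    have hi := Finset.mem_compl.1 hi
    have h2 := h.derivation_nonface _ (nonface_insert hΔ hI hi) 1
    have h3 := h.vertex w
    rw [hI] at h3
    rw [mul_one, faceMonomial_insert hi, Derivation.leibniz, directionalDerivation_X,
      directionalDerivation_faceMonomial, map_add, add_comm, smul_eq_mul, smul_eq_mul, mul_comm,
      ← smul_eq_C_mul, map_smul, h3, Finset.mul_sum, map_sum, ← Algebra.algebraMap_eq_smul_one]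
      at h2
    rw [← h2]
    congr 1
    refine Finset.sum_congr rfl fun j _ => ?_
    rw [mul_left_comm, ← smul_eq_C_mul, map_smul]
  have h2 := Finset.sum_congr rfl h1
  rw [Finset.sum_const_zero, Finset.sum_add_distrib, Finset.sum_comm] at h2
  rw [map_sum, ← Finset.sum_add_sum_compl (activeSet η κ w), add_comm, ← h2]
  congr 1
  refine Finset.sum_congr rfl fun j hj => ?_
  obtain ⟨u, k', hu, hk, hact, hseg, -, -⟩ := hΔ.exists_edge w.2 (he w) hj
  rw [← Finset.smul_sum, Finset.sum_congr rfl fun i hi =>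
    h.X_mul_faceMonomial hI hu hact hseg (Finset.mem_compl.1 hi), Finset.sum_ite_eq',
    if_pos (Finset.mem_compl.2 hk), Algebra.algebraMap_eq_smul_one]

/-- The pairing of the class of the polytope with an edge is the length of the edge. -/
theorem linearForm_mul_edge (h : IsVolumeFunctional D γ ψ)
    (hI : ∀ v, D.I v = activeSet η κ v)
    (hD : ∀ v i j, D.coeff v i j = ((η j ⬝ᵥ e v i : ℤ) : ℝ))
    (he : ∀ v : (polytope η κ).extremePoints ℝ, IsDualFamily η (activeSet η κ v) (e v))
    {w : (polytope η κ).extremePoints ℝ} {u : Fin n → ℝ} {j k' : Fin N}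
    (hu : u ∈ (polytope η κ).extremePoints ℝ) (hk : k' ∉ activeSet η κ w)
    (hact : activeSet η κ u = insert k' ((activeSet η κ w).erase j))
    (hseg : face η κ ((activeSet η κ w).erase j) = segment ℝ u w) :
    ψ (linearForm κ * faceMonomial ((activeSet η κ w).erase j)) =
      algebraMap ℝ k (κ k' - toReal (η k') ⬝ᵥ (w : Fin n → ℝ)) := by
  -- Translating w to the origin does not change the pairing and makes the coefficients of the
  -- facets through w vanish, so only the facet at the far end contributes.
  set c : Fin N → ℝ := fun i => toReal (η i) ⬝ᵥ (w : Fin n → ℝ)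
  have h0 : linearForm κ = linearForm (κ - c) + linearForm c := by rw [linearForm_sub]; ring
  rw [h0, add_mul, map_add, h.linearForm_dotProduct hI hD he w, add_zero, linearForm_mul_apply,
    Finset.sum_eq_single k']
  · rw [h.X_mul_faceMonomial hI hu hact hseg hk, if_pos rfl, Algebra.algebraMap_eq_smul_one]
    rfl
  · intro i _ hik
    by_cases hi : i ∈ activeSet η κ w
    · rw [Pi.sub_apply, show c i = κ i from mem_activeSet.1 hi, sub_self, zero_smul]
    · rw [h.X_mul_faceMonomial hI hu hact hseg hi, if_neg hik, smul_zero]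
  · simp

/-- Expanding ψ(d(y X_{I(w)})) over all vertices w produces the trace value |V| ∑ κ_i γ_i plus the
edge sum; comparison with `sum_derivation_mul_vertex` leaves zero for the latter. -/
theorem sum_directedEdges_eq_zero [Nontrivial k] (h : IsVolumeFunctional D γ ψ)
    (hΔ : IsSmoothPolytope η κ) (hI : ∀ v, D.I v = activeSet η κ v)
    (hD : ∀ v i j, D.coeff v i j = ((η j ⬝ᵥ e v i : ℤ) : ℝ))
    (he : ∀ v : (polytope η κ).extremePoints ℝ, IsDualFamily η (activeSet η κ v) (e v)) :
    ∑ a ∈ (finite_directedEdges η κ).toFinset, affineLength a.1 a.2.1 * γ a.2.2 = 0 := by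
  classical
  have := hΔ.finite_extremePoints.fintype
  refine (algebraMap ℝ k).injective ?_
  have h1 : ∑ a ∈ (finite_directedEdges η κ).toFinset,
      algebraMap ℝ k (affineLength a.1 a.2.1 * γ a.2.2) =
      ∑ p ∈ (Finset.univ : Finset ((polytope η κ).extremePoints ℝ)).sigma
        (fun w => activeSet η κ w),
        γ p.2 • ψ (linearForm κ * faceMonomial ((activeSet η κ p.1).erase p.2)) := by
    refine Finset.sum_bij (fun a ha => ⟨⟨a.2.1, (hΔ.of_mem_directedEdges
      ((Set.Finite.mem_toFinset _).1 ha)).1⟩, a.2.2⟩) ?_ ?_ ?_ ?_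
    · rintro ⟨v, w, j⟩ ha
      exact Finset.mem_sigma.2 ⟨Finset.mem_univ _, (hΔ.of_mem_directedEdges
        ((Set.Finite.mem_toFinset _).1 ha)).2.1⟩
    · rintro ⟨v, w, j⟩ ha ⟨v', w', j'⟩ ha' heq
      simp only [Sigma.mk.injEq, Subtype.mk.injEq, heq_eq_eq] at heq
      obtain ⟨rfl, rfl⟩ := heq
      rw [Set.Finite.mem_toFinset] at ha ha'
      have h2 := (hΔ.of_mem_directedEdges ha).2.2
      rw [(hΔ.of_mem_directedEdges ha').2.2] at h2
      rcases mem_pair_of_segment_eq h2.symm with h3 | h3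
      · rw [h3]
      · exact absurd h3 ha.1
    · rintro ⟨w, j⟩ hp
      have hj : j ∈ activeSet η κ w := (Finset.mem_sigma.1 hp).2
      obtain ⟨u, k', hu, hk, hact, hseg, hpos, -⟩ := hΔ.exists_edge w.2 (he w) hj
      refine ⟨(u, w, j), (Set.Finite.mem_toFinset _).2 ⟨fun huw => ?_, ⟨_, hseg⟩,
        ⟨w.2.1, mem_activeSet.1 hj⟩, fun hc => ?_⟩, rfl⟩
      · simp only at huw
        rw [← huw] at hk
        nth_rw 1 [hact] at hk
        exact hk (Finset.mem_insert_self _ _)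
      · have h2 : j ∈ activeSet η κ u := mem_activeSet.2 hc.2
        rw [hact, Finset.mem_insert] at h2
        rcases h2 with rfl | h2
        · exact hk hj
        · exact Finset.notMem_erase _ _ h2
    · rintro ⟨v, w, j⟩ ha
      rw [Set.Finite.mem_toFinset] at ha
      obtain ⟨hw, hj, hface⟩ := hΔ.of_mem_directedEdges ha
      obtain ⟨u, k', hu, hk, hact, hseg, hpos, hdiff⟩ := hΔ.exists_edge hw (he ⟨w, hw⟩) hj
      have hvu : v = u := by
        rcases mem_pair_of_segment_eq (hface.symm.trans hseg) with h3 | h3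
        · exact h3
        · exact absurd h3 ha.1
      subst hvu
      have h2 := h.linearForm_mul_edge (w := ⟨w, hw⟩) hI hD he hu hk hact hseg
      simp only at h2 ⊢
      rw [h2, affineLength_eq hpos.le ((he ⟨w, hw⟩).isPrimitive hj) hdiff, map_mul, mul_comm,
        Algebra.smul_def]
  have h2 : ∀ w, ψ (directionalDerivation γ (linearForm κ * faceMonomial (D.I w))) =
      algebraMap ℝ k (∑ i, κ i * γ i) + ∑ j ∈ activeSet η κ w,
        γ j • ψ (linearForm κ * faceMonomial ((activeSet η κ w).erase j)) := by
    intro w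
    rw [Derivation.leibniz, directionalDerivation_linearForm, directionalDerivation_faceMonomial,
      map_add, add_comm, smul_eq_mul, smul_eq_mul, mul_comm, ← smul_eq_C_mul, map_smul, h.vertex,
      ← Algebra.algebraMap_eq_smul_one, Finset.mul_sum, map_sum ψ, hI]
    congr 1
    refine Finset.sum_congr rfl fun j _ => ?_
    rw [mul_left_comm, ← smul_eq_C_mul, map_smul]
  have h3 := h.sum_derivation_mul_vertex κ
  rw [Finset.sum_congr rfl fun w _ => h2 w] at h3
  rw [Finset.sum_add_distrib, Finset.sum_const, Finset.card_univ, nsmul_eq_mul, map_mul,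
    map_natCast] at h3
  rw [map_sum, h1, Finset.sum_sigma, map_zero]
  exact add_eq_left.1 h3

end IsVolumeFunctional

end Edges

end MassLinear

namespace MassLinear

open MeasureTheory Filter Topology MvPolynomial

/-! ### Germs in the support constants and the step size. -/

section Germs

variable {ι : Type*} [Fintype ι] [DecidableEq ι]

/-- Support constants close to `κ`, together with a small positive step size. -/
def stepFilter (κ : ι → ℝ) : Filter ((ι → ℝ) × ℝ) := 𝓝 κ ×ˢ 𝓝[>] 0

instance (κ : ι → ℝ) : (stepFilter κ).NeBot := inferInstanceAs (𝓝 κ ×ˢ 𝓝[>] 0).NeBot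

theorem eventually_stepFilter {κ : ι → ℝ} {δ : ℝ} (hδ : 0 < δ) :
    ∀ᶠ p in stepFilter κ, (∀ i, |p.1 i - κ i| < δ) ∧ 0 < p.2 ∧ p.2 < δ := by
  have h1 : ∀ᶠ x in 𝓝 κ, ∀ i, |x i - κ i| < δ := by
    filter_upwards [Metric.ball_mem_nhds κ hδ] with x hx i
    exact lt_of_le_of_lt (dist_le_pi_dist x κ i) hx
  have h2 : ∀ᶠ t in 𝓝[>] (0 : ℝ), 0 < t ∧ t < δ := Ioo_mem_nhdsGT hδ
  exact h1.prod_mk h2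

/-- The ideal of functions whose germ vanishes. -/
def nullIdeal (κ : ι → ℝ) : Ideal ((ι → ℝ) × ℝ → ℝ) where
  carrier := {f | ∀ᶠ p in stepFilter κ, f p = 0}
  add_mem' {f g} hf hg := by
    change ∀ᶠ p in stepFilter κ, f p + g p = 0
    filter_upwards [show ∀ᶠ p in stepFilter κ, f p = 0 from hf,
      show ∀ᶠ p in stepFilter κ, g p = 0 from hg] with p h₁ h₂
    rw [h₁, h₂, add_zero]
  zero_mem' := by
    change ∀ᶠ p in stepFilter κ, (0 : ℝ) = 0
    exact Eventually.of_forall fun _ => rfl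
  smul_mem' r f hf := by
    change ∀ᶠ p in stepFilter κ, r p * f p = 0
    filter_upwards [show ∀ᶠ p in stepFilter κ, f p = 0 from hf] with p h
    rw [h, mul_zero]

theorem mem_nullIdeal {κ : ι → ℝ} {f : (ι → ℝ) × ℝ → ℝ} :
    f ∈ nullIdeal κ ↔ ∀ᶠ p in stepFilter κ, f p = 0 := Iff.rfl

/-- Germs of functions of the support constants and the step size. -/
abbrev StepGerm (κ : ι → ℝ) := ((ι → ℝ) × ℝ → ℝ) ⧸ nullIdeal κ

/-- The germ of a function. -/
def stepGerm (κ : ι → ℝ) (f : (ι → ℝ) × ℝ → ℝ) : StepGerm κ := Ideal.Quotient.mk _ f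

theorem stepGerm_eq {κ : ι → ℝ} {f g : (ι → ℝ) × ℝ → ℝ} :
    stepGerm κ f = stepGerm κ g ↔ ∀ᶠ p in stepFilter κ, f p = g p := by
  rw [stepGerm, stepGerm, Ideal.Quotient.eq, mem_nullIdeal]
  simp only [Pi.sub_apply, sub_eq_zero]

instance (κ : ι → ℝ) : Nontrivial (StepGerm κ) := by
  refine Ideal.Quotient.nontrivial_iff.2 fun h => ?_
  have h1 : (1 : (ι → ℝ) × ℝ → ℝ) ∈ nullIdeal κ := h ▸ trivial
  obtain ⟨p, hp⟩ := (mem_nullIdeal.1 h1).exists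
  exact one_ne_zero hp

/-- Shift the support constants by a multiple of the step size. -/
def shiftMap (u : ι → ℤ) (p : (ι → ℝ) × ℝ) : (ι → ℝ) × ℝ :=
  (p.1 + p.2 • fun i => (u i : ℝ), p.2)

theorem tendsto_shiftMap (κ : ι → ℝ) (u : ι → ℤ) :
    Tendsto (shiftMap u) (stepFilter κ) (stepFilter κ) := by
  refine Tendsto.prodMk ?_ tendsto_snd
  have h1 : Tendsto (fun p : (ι → ℝ) × ℝ => p.1) (stepFilter κ) (𝓝 κ) := tendsto_fst
  have h2 : Tendsto (fun p : (ι → ℝ) × ℝ => p.2) (stepFilter κ) (𝓝 0) :=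
    (tendsto_snd : Tendsto _ _ (𝓝[>] (0 : ℝ))).mono_right nhdsWithin_le_nhds
  simpa using h1.add (h2.smul_const fun i => (u i : ℝ))

/-- The pullback of functions under a shift. -/
def shiftPullback (u : ι → ℤ) : ((ι → ℝ) × ℝ → ℝ) →ₐ[ℝ] ((ι → ℝ) × ℝ → ℝ) where
  toFun f := f ∘ shiftMap u
  map_one' := rfl
  map_mul' _ _ := rfl
  map_zero' := rfl
  map_add' _ _ := rfl
  commutes' _ := rfl

/-- The action of a shift on germs. -/
noncomputable def shiftGerm (κ : ι → ℝ) (u : ι → ℤ) : StepGerm κ →ₐ[ℝ] StepGerm κ :=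
  Ideal.quotientMapₐ (nullIdeal κ) (shiftPullback u) fun _ hf => (tendsto_shiftMap κ u).eventually hf

/-- The action of the lattice of shifts on germs. -/
noncomputable def shiftAction (κ : ι → ℝ) :
    Multiplicative (ι → ℤ) →* Module.End ℝ (StepGerm κ) where
  toFun u := (shiftGerm κ u.toAdd).toLinearMap
  map_one' := by
    refine LinearMap.ext fun x => ?_
    obtain ⟨f, rfl⟩ := Ideal.Quotient.mk_surjective x
    change stepGerm κ _ = stepGerm κ _
    congr 1
    funext p
    refine congrArg f (Prod.ext (funext fun i => ?_) rfl)
    simp [shiftMap]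
  map_mul' u w := by
    refine LinearMap.ext fun x => ?_
    obtain ⟨f, rfl⟩ := Ideal.Quotient.mk_surjective x
    change stepGerm κ _ = stepGerm κ _
    congr 1
    funext p
    refine congrArg f (Prod.ext (funext fun i => ?_) rfl)
    simp [shiftMap]
    ring

theorem shiftAction_stepGerm (κ : ι → ℝ) (u : Multiplicative (ι → ℤ)) (f : (ι → ℝ) × ℝ → ℝ) :
    shiftAction κ u (stepGerm κ f) = stepGerm κ (f ∘ shiftMap u.toAdd) := rfl

theorem differenceOp_X_stepGerm (κ : ι → ℝ) (i : ι) (f : (ι → ℝ) × ℝ → ℝ) :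
    differenceOp (shiftAction κ) (X i) (stepGerm κ f) =
      stepGerm κ fun p => f p - f (shiftMap (-Pi.single i 1) p) := by
  rw [differenceOp_X]
  rfl

end Germs

/-! ### Volumes and integrals over strips near the facets. -/

section Volume

variable {n N : ℕ} {η : Fin N → Fin n → ℤ} {κ : Fin N → ℝ}

/-- The part of the polytope which is close to the given facets. -/
def strip (η : Fin N → Fin n → ℤ) (K : Finset (Fin N)) (p : (Fin N → ℝ) × ℝ) : Set (Fin n → ℝ) :=
  {x ∈ polytope η p.1 | ∀ i ∈ K, p.1 i - p.2 < toReal (η i) ⬝ᵥ x}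

theorem measurableSet_strip (η : Fin N → Fin n → ℤ) (K : Finset (Fin N)) (p : (Fin N → ℝ) × ℝ) :
    MeasurableSet (strip η K p) := by
  have : strip η K p = polytope η p.1 ∩ ⋂ i ∈ K, {x | p.1 i - p.2 < toReal (η i) ⬝ᵥ x} := by
    ext x
    simp [strip]
  rw [this]
  exact (isClosed_polytope η p.1).measurableSet.inter (Finset.measurableSet_biInter _ fun i _ =>
    (isOpen_lt continuous_const (continuous_dotProduct_left _)).measurableSet)

theorem strip_empty (η : Fin N → Fin n → ℤ) (p : (Fin N → ℝ) × ℝ) :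
    strip η ∅ p = polytope η p.1 := by
  simp [strip]

/-- Lowering the i-th support constant by the step cuts off exactly the points near F_i; the strict
inequality in `strip` makes this an equality of sets. -/
theorem strip_shiftMap {K : Finset (Fin N)} {i : Fin N} (hi : i ∉ K) {p : (Fin N → ℝ) × ℝ}
    (hp : 0 ≤ p.2) : strip η K (shiftMap (-Pi.single i 1) p) =
      strip η K p \ strip η (insert i K) p := by
  have hs : (shiftMap (-Pi.single i 1) p).1 i = p.1 i - p.2 := by simp [shiftMap, sub_eq_add_neg]
  have hn : ∀ j, j ≠ i → (shiftMap (-Pi.single i 1) p).1 j = p.1 j := fun j hj => by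
    simp [shiftMap, hj]
  ext x
  constructor
  · rintro ⟨h1, h2⟩
    have hxi := h1 i
    rw [hs] at hxi
    refine ⟨⟨fun j => ?_, fun j hj => ?_⟩, fun hc => ?_⟩
    · by_cases hj : j = i
      · subst hj
        linarith
      · exact hn j hj ▸ h1 j
    · have := h2 j hj
      rwa [hn j (fun e => hi (e ▸ hj))] at this
    · exact absurd (hc.2 i (Finset.mem_insert_self _ _)) (not_lt.2 hxi)
  · rintro ⟨⟨h1, h2⟩, h3⟩
    refine ⟨fun j => ?_, fun j hj => ?_⟩
    · by_cases hj : j = i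
      · subst hj
        rw [hs]
        by_contra! hlt
        exact h3 ⟨h1, fun l hl => (Finset.mem_insert.1 hl).elim (fun e => e ▸ hlt) (h2 l)⟩
      · rw [hn j hj]
        exact h1 j
    · rw [hn j (fun e => hi (e ▸ hj))]
      exact h2 j hj

namespace IsSmoothPolytope

theorem exists_interior (hΔ : IsSmoothPolytope η κ) :
    ∃ x : Fin n → ℝ, ∀ i, toReal (η i) ⬝ᵥ x < κ i := by
  obtain ⟨w, hw, -⟩ := hΔ.exists_lowest_vertex (I := ∅) 0 (by simpa [face] using hΔ.nonempty)
  obtain ⟨e, he⟩ := hΔ.exists_isDualFamily hw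
  -- It pairs to 1 with every conormal at w, so −d points strictly inside all facets through w.
  set d : Fin n → ℝ := ∑ j ∈ activeSet η κ w, toReal (e j) with hd
  have h : ∀ᶠ t in 𝓝[>] (0 : ℝ), ∀ i, toReal (η i) ⬝ᵥ (w - t • d) < κ i := by
    rw [eventually_all]
    intro i
    by_cases hi : i ∈ activeSet η κ w
    · have h1 : toReal (η i) ⬝ᵥ d = 1 := by
        rw [hd, dotProduct_sum, Finset.sum_eq_single i]
        · rw [toReal_dotProduct, he.pairing_self i hi, Int.cast_one]
        · intro j hj hji
          rw [toReal_dotProduct, he.pairing_ne j hj i hi hji.symm, Int.cast_zero]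
        · exact fun h => absurd hi h
      filter_upwards [self_mem_nhdsWithin] with t ht
      rw [dotProduct_sub, dotProduct_smul, h1, mem_activeSet.1 hi, smul_eq_mul, mul_one]
      exact sub_lt_self _ ht
    · have hlt : toReal (η i) ⬝ᵥ (w - (0 : ℝ) • d) < κ i := by
        rw [zero_smul, sub_zero]
        exact lt_of_le_of_ne (hw.1 i) fun e => hi (mem_activeSet.2 e)
      have hc : Continuous fun t : ℝ => toReal (η i) ⬝ᵥ (w - t • d) :=
        (continuous_dotProduct_left _).comp (by fun_prop)
      exact ((hc.tendsto 0).eventually_lt_const hlt).filter_mono nhdsWithin_le_nhds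
  obtain ⟨t, ht⟩ := h.exists
  exact ⟨_, ht⟩

/-- Contracting Δ(κ') towards an interior point of Δ(κ) by a small factor s places it inside Δ(κ),
which is bounded. -/
theorem isBounded_polytope (hΔ : IsSmoothPolytope η κ) (κ' : Fin N → ℝ) :
    Bornology.IsBounded (polytope η κ') := by
  obtain ⟨p, hp⟩ := hΔ.exists_interior
  have h : ∀ᶠ s in 𝓝[>] (0 : ℝ), ∀ i,
      (1 - s) * (toReal (η i) ⬝ᵥ p) + s * κ' i < κ i := by
    rw [eventually_all]
    intro i
    have hc : Continuous fun s : ℝ => (1 - s) * (toReal (η i) ⬝ᵥ p) + s * κ' i := by fun_prop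
    exact ((hc.tendsto 0).eventually_lt_const (by simpa using hp i)).filter_mono
      nhdsWithin_le_nhds
  obtain ⟨s, hs, hs0⟩ := (h.and self_mem_nhdsWithin).exists
  have hs0 : 0 < s := hs0
  obtain ⟨R, hR⟩ := hΔ.isBounded.subset_closedBall p
  refine (Metric.isBounded_closedBall (x := p) (r := R / s)).subset fun x hx => ?_
  have h1 : p + s • (x - p) ∈ polytope η κ := fun i => by
    rw [dotProduct_add, dotProduct_smul, dotProduct_sub, smul_eq_mul]
    have h2 := mul_le_mul_of_nonneg_left (hx i) hs0.le
    have h3 := hs i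
    nlinarith
  have h2 := hR h1
  rw [Metric.mem_closedBall, dist_eq_norm, add_sub_cancel_left, norm_smul,
    Real.norm_of_nonneg hs0.le] at h2
  rw [Metric.mem_closedBall, dist_eq_norm, le_div_iff₀ hs0, mul_comm]
  exact h2

theorem isCompact_polytope (hΔ : IsSmoothPolytope η κ) (κ' : Fin N → ℝ) :
    IsCompact (polytope η κ') :=
  Metric.isCompact_of_isClosed_isBounded (isClosed_polytope η κ') (hΔ.isBounded_polytope κ')

theorem integrableOn_strip (hΔ : IsSmoothPolytope η κ) {g : (Fin n → ℝ) → ℝ} (hg : Continuous g)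
    (K : Finset (Fin N)) (p : (Fin N → ℝ) × ℝ) : IntegrableOn g (strip η K p) :=
  (hg.continuousOn.integrableOn_compact (hΔ.isCompact_polytope p.1)).mono_set fun _ hx => hx.1

/-- Points that nearly lie on the facets of an empty face cannot nearly lie in the polytope. -/
theorem exists_pos_of_face_eq_empty (hΔ : IsSmoothPolytope η κ) {I : Finset (Fin N)}
    (hI : face η κ I = ∅) : ∃ δ > 0, ∀ x, (∀ k, toReal (η k) ⬝ᵥ x ≤ κ k + δ) →
      ∃ i ∈ I, toReal (η i) ⬝ᵥ x < κ i - δ := by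
  -- The total violation of the conditions defining F_I. It is continuous and has no zero, so its
  -- minimum on a compact enlargement of the polytope is positive.
  let f : (Fin n → ℝ) → ℝ := fun x => ∑ k, max (toReal (η k) ⬝ᵥ x - κ k) 0 +
    ∑ i ∈ I, max (κ i - toReal (η i) ⬝ᵥ x) 0
  have hf : Continuous f := by
    have := fun i => continuous_dotProduct_left (toReal (η i))
    fun_prop
  obtain ⟨x₁, hx₁⟩ := hΔ.nonempty
  obtain ⟨x₀, hx₀, hmin⟩ := (hΔ.isCompact_polytope (fun k => κ k + 1)).exists_isMinOn
    ⟨x₁, fun k => (hx₁ k).trans (by linarith)⟩ hf.continuousOn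
  have hpos1 : ∀ x, ∀ k ∈ Finset.univ, 0 ≤ max (toReal (η k) ⬝ᵥ x - κ k) 0 :=
    fun x k _ => le_max_right _ _
  have hpos2 : ∀ x, ∀ k ∈ I, 0 ≤ max (κ k - toReal (η k) ⬝ᵥ x) 0 := fun x k _ => le_max_right _ _
  have hc : 0 < f x₀ := by
    refine lt_of_le_of_ne (add_nonneg (Finset.sum_nonneg (hpos1 x₀))
      (Finset.sum_nonneg (hpos2 x₀))) fun h0 => ?_
    obtain ⟨h1, h2⟩ := (add_eq_zero_iff_of_nonneg (Finset.sum_nonneg (hpos1 x₀))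
      (Finset.sum_nonneg (hpos2 x₀))).1 h0.symm
    rw [Finset.sum_eq_zero_iff_of_nonneg (hpos1 x₀)] at h1
    rw [Finset.sum_eq_zero_iff_of_nonneg (hpos2 x₀)] at h2
    have hmem : x₀ ∈ polytope η κ := fun k => by
      have := max_eq_right_iff.1 (h1 k (Finset.mem_univ k))
      linarith
    have : x₀ ∈ face η κ I := mem_face.2 ⟨hmem, fun i hi => mem_activeSet.2 <| by
      have := max_eq_right_iff.1 (h2 i hi)
      have := hmem i
      linarith⟩
    rw [hI] at this
    exact this
  -- The number of summands of f: if each is at most δ, then f ≤ m δ, which is below the minimum for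
  -- δ ≤ f x₀ / (m + 1). The bound δ ≤ 1 keeps x in the enlargement.
  set m : ℝ := N + I.card with hm
  have hm0 : 0 ≤ m := by positivity
  refine ⟨min 1 (f x₀ / (m + 1)), lt_min one_pos (by positivity), fun x hx => ?_⟩
  set δ := min 1 (f x₀ / (m + 1))
  have hδ0 : 0 < δ := lt_min one_pos (by positivity)
  by_contra! hxI
  have h1 : f x₀ ≤ f x := hmin fun k => (hx k).trans (by
    have : δ ≤ 1 := min_le_left _ _
    linarith)
  have h2 : f x ≤ m * δ := by
    have e1 : ∑ k, max (toReal (η k) ⬝ᵥ x - κ k) 0 ≤ N * δ := by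
      refine (Finset.sum_le_card_nsmul _ _ δ fun k _ => max_le ?_ hδ0.le).trans ?_
      · have := hx k
        linarith
      · simp
    have e2 : ∑ i ∈ I, max (κ i - toReal (η i) ⬝ᵥ x) 0 ≤ I.card * δ := by
      refine (Finset.sum_le_card_nsmul _ _ δ fun k hk => max_le ?_ hδ0.le).trans ?_
      · have := hxI k hk
        linarith
      · simp
    rw [hm, add_mul]
    exact add_le_add e1 e2
  have h3 : (m + 1) * δ ≤ f x₀ := by
    have : δ ≤ f x₀ / (m + 1) := min_le_right _ _
    rwa [le_div_iff₀ (by positivity), mul_comm] at this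
  nlinarith

theorem eventually_strip_eq_empty (hΔ : IsSmoothPolytope η κ) {K : Finset (Fin N)}
    (hK : face η κ K = ∅) : ∀ᶠ p in stepFilter κ, strip η K p = ∅ := by
  obtain ⟨δ, hδ, h⟩ := hΔ.exists_pos_of_face_eq_empty hK
  filter_upwards [eventually_stepFilter (half_pos hδ)] with p hp
  refine Set.eq_empty_iff_forall_notMem.2 fun x hx => ?_
  obtain ⟨i, hi, hlt⟩ := h x fun k => by
    have h1 := hx.1 k
    have h2 := (abs_lt.1 (hp.1 k)).2
    linarith
  have h1 := hx.2 i hi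
  have h2 := (abs_lt.1 (hp.1 i)).1
  linarith [hp.2.2]

/-- The chamber is a neighbourhood of κ: a vertex moves linearly with κ' and keeps its slack in the
other inequalities, while an empty face stays empty since its strip does. -/
theorem eventually_mem_chamber (hΔ : IsSmoothPolytope η κ) :
    ∀ᶠ p in stepFilter κ, p.1 ∈ chamber η κ := by
  change ∀ᶠ p in stepFilter κ, ∀ I, (face η p.1 I).Nonempty ↔ (face η κ I).Nonempty
  rw [eventually_all]
  intro I
  by_cases hI : (face η κ I).Nonempty
  · obtain ⟨v, hv, hIv⟩ := hΔ.face_nonempty_iff.1 hI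
    obtain ⟨e, he⟩ := hΔ.exists_isDualFamily hv
    let x : (Fin N → ℝ) → Fin n → ℝ :=
      fun κ' => v + ∑ i ∈ activeSet η κ v, (κ' i - κ i) • toReal (e i)
    have hx : Continuous x := by fun_prop
    have hxκ : x κ = v := by simp [x]
    have h1 : ∀ κ', ∀ i ∈ activeSet η κ v, toReal (η i) ⬝ᵥ x κ' = κ' i := by
      intro κ' i hi
      simp only [x]
      rw [dotProduct_add, dotProduct_sum, mem_activeSet.1 hi, Finset.sum_eq_single i]
      · rw [dotProduct_smul, toReal_dotProduct, he.pairing_self i hi, Int.cast_one, smul_eq_mul,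
          mul_one, add_sub_cancel]
      · intro j hj hji
        rw [dotProduct_smul, toReal_dotProduct, he.pairing_ne j hj i hi hji.symm, Int.cast_zero,
          smul_zero]
      · exact fun h => absurd hi h
    have h2 : ∀ᶠ κ' in 𝓝 κ, ∀ i, toReal (η i) ⬝ᵥ x κ' ≤ κ' i := by
      rw [eventually_all]
      intro i
      by_cases hi : i ∈ activeSet η κ v
      · exact Eventually.of_forall fun κ' => (h1 κ' i hi).le
      · have hc : Continuous fun κ' => toReal (η i) ⬝ᵥ x κ' :=
          (continuous_dotProduct_left _).comp hx
        have hlt : toReal (η i) ⬝ᵥ x κ < κ i := by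
          rw [hxκ]
          exact lt_of_le_of_ne (hv.1 i) fun e => hi (mem_activeSet.2 e)
        exact (hc.continuousAt.eventually_lt (continuous_apply i).continuousAt hlt).mono
          fun _ h => h.le
    have h3 : Tendsto (fun p : (Fin N → ℝ) × ℝ => p.1) (stepFilter κ) (𝓝 κ) := tendsto_fst
    filter_upwards [h3.eventually h2] with p hp
    exact iff_of_true ⟨x p.1, mem_face.2 ⟨hp, fun i hi => mem_activeSet.2 (h1 _ i (hIv hi))⟩⟩ hI
  · filter_upwards [hΔ.eventually_strip_eq_empty (Set.not_nonempty_iff_eq_empty.1 hI),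
      eventually_stepFilter one_pos] with p hp hp'
    refine iff_of_false ?_ hI
    rintro ⟨x, hx⟩
    have : x ∈ strip η I p := ⟨hx.1, fun i hi => by
      rw [mem_activeSet.1 ((mem_face.1 hx).2 hi)]
      linarith [hp'.2.1]⟩
    rw [hp] at this
    exact this

/-- The volume of a unimodular parallelepiped. -/
theorem volume_parallelepiped (hΔ : IsSmoothPolytope η κ) {v : Fin n → ℝ}
    (hv : v ∈ (polytope η κ).extremePoints ℝ) (p : (Fin N → ℝ) × ℝ) :
    volume {x : Fin n → ℝ | ∀ i ∈ activeSet η κ v,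
      toReal (η i) ⬝ᵥ x ∈ Set.Ioc (p.1 i - p.2) (p.1 i)} = ENNReal.ofReal p.2 ^ n := by
  obtain ⟨e, he⟩ := hΔ.exists_isDualFamily hv
  let σ : Fin n ≃ activeSet η κ v :=
    (finCongr (hΔ.card_activeSet hv).symm).trans (activeSet η κ v).equivFin.symm
  let M : Matrix (Fin n) (Fin n) ℤ := Matrix.of fun r c => η (σ r) c
  let E : Matrix (Fin n) (Fin n) ℤ := Matrix.of fun c r => e (σ r) c
  have hME : M * E = 1 := by
    ext r s
    change η (σ r) ⬝ᵥ e (σ s) = _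
    by_cases hrs : r = s
    · subst hrs
      rw [Matrix.one_apply_eq, he.pairing_self _ (σ r).2]
    · rw [Matrix.one_apply_ne hrs, he.pairing_ne _ (σ s).2 _ (σ r).2]
      exact fun h => hrs (σ.injective (Subtype.ext h))
  let f := Matrix.toLin' (M.map (Int.cast : ℤ → ℝ))
  -- The matrix of conormals has an integral inverse, given by the dual basis, so its determinant is
  -- ±1.
  have hdet : |LinearMap.det f| = 1 := by
    have h1 : M.det * E.det = 1 := by rw [← Matrix.det_mul, hME, Matrix.det_one]
    have h2 : LinearMap.det f = (M.det : ℝ) := by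
      rw [LinearMap.det_toLin']
      exact (Int.cast_det M).symm
    rw [h2]
    rcases Int.isUnit_iff.1 (IsUnit.of_mul_eq_one _ h1) with h | h <;> simp [h]
  have hset : {x : Fin n → ℝ | ∀ i ∈ activeSet η κ v,
      toReal (η i) ⬝ᵥ x ∈ Set.Ioc (p.1 i - p.2) (p.1 i)} =
      f ⁻¹' Set.pi Set.univ fun r => Set.Ioc (p.1 (σ r) - p.2) (p.1 (σ r)) := by
    ext x
    have hfx : ∀ r, f x r = toReal (η (σ r)) ⬝ᵥ x := fun r => rfl
    simp only [Set.mem_preimage, Set.mem_univ_pi, hfx]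
    exact ⟨fun h r => h _ (σ r).2, fun h i hi => by simpa using h (σ.symm ⟨i, hi⟩)⟩
  have hne : LinearMap.det f ≠ 0 := fun h => by simp [h] at hdet
  rw [hset, Measure.addHaar_preimage_linearMap _ hne, abs_inv, hdet, inv_one, ENNReal.ofReal_one,
    one_mul, Real.volume_pi_Ioc]
  simp

theorem eventually_strip_vertex (hΔ : IsSmoothPolytope η κ) {v : Fin n → ℝ}
    (hv : v ∈ (polytope η κ).extremePoints ℝ) : ∀ᶠ p in stepFilter κ,
      strip η (activeSet η κ v) p = {x : Fin n → ℝ | ∀ i ∈ activeSet η κ v,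
        toReal (η i) ⬝ᵥ x ∈ Set.Ioc (p.1 i - p.2) (p.1 i)} := by
  obtain ⟨e, he⟩ := hΔ.exists_isDualFamily hv
  let A : Fin N → ℝ := fun k => ∑ i ∈ activeSet η κ v, |toReal (η k) ⬝ᵥ toReal (e i)|
  -- Each coordinate of x − v is at most 2δ in size, δ from the support constant and δ from the
  -- step, which moves the k-th pairing by at most 2δ A_k; another δ covers the change of κ_k.
  have hδ : ∀ᶠ δ in 𝓝[>] (0 : ℝ), ∀ k, k ∉ activeSet η κ v →
      toReal (η k) ⬝ᵥ v + δ * (2 * A k + 1) < κ k := by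
    rw [eventually_all]
    intro k
    by_cases hk : k ∈ activeSet η κ v
    · exact Eventually.of_forall fun _ h => absurd hk h
    · have hlt : toReal (η k) ⬝ᵥ v + 0 * (2 * A k + 1) < κ k := by
        rw [zero_mul, add_zero]
        exact lt_of_le_of_ne (hv.1 k) fun e => hk (mem_activeSet.2 e)
      have hc : Continuous fun δ : ℝ => toReal (η k) ⬝ᵥ v + δ * (2 * A k + 1) := by fun_prop
      exact (((hc.tendsto 0).eventually_lt_const hlt).filter_mono nhdsWithin_le_nhds).mono
        fun _ h _ => h
  obtain ⟨δ, hδ, hδ0⟩ := (hδ.and self_mem_nhdsWithin).exists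
  have hδ0 : 0 < δ := hδ0
  filter_upwards [eventually_stepFilter hδ0] with p hp
  ext x
  refine ⟨fun hx i hi => ⟨hx.2 i hi, hx.1 i⟩, fun hx => ⟨fun k => ?_, fun i hi => (hx i hi).1⟩⟩
  by_cases hk : k ∈ activeSet η κ v
  · exact (hx k hk).2
  have h1 : toReal (η k) ⬝ᵥ x - toReal (η k) ⬝ᵥ v ≤ 2 * δ * A k := by
    rw [← dotProduct_sub, he.expansion (x - v), dotProduct_sum, Finset.mul_sum]
    refine Finset.sum_le_sum fun i hi => ?_
    rw [dotProduct_smul, smul_eq_mul, dotProduct_sub, mem_activeSet.1 hi]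
    have hi1 := hx i hi
    have hi2 := abs_lt.1 (hp.1 i)
    refine (le_abs_self _).trans ?_
    rw [abs_mul]
    refine mul_le_mul_of_nonneg_right (abs_le.2 ⟨?_, ?_⟩) (abs_nonneg _)
    · linarith [hi1.1, hi2.1, hp.2.2]
    · linarith [hi1.2, hi2.2]
  have h2 := hδ k hk
  have h3 := (abs_lt.1 (hp.1 k)).1
  linarith

-- Each further difference subtracts the integral over the strip that remains after cutting along
-- F_i, and so leaves the integral over the part near F_i. It holds for any continuous integrand,
-- hence for both the volume and the moment of H.
open Classical in
theorem differenceOp_faceMonomial (hΔ : IsSmoothPolytope η κ) {g : (Fin n → ℝ) → ℝ}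
    (hg : Continuous g) (K : Finset (Fin N)) :
    differenceOp (shiftAction κ) (faceMonomial K)
        (stepGerm κ fun p => ∫ x in polytope η p.1, g x) =
      stepGerm κ fun p => ∫ x in strip η K p, g x := by
  induction K using Finset.induction_on with
  | empty => simp [faceMonomial, strip_empty]
  | insert i K hi ih =>
    rw [faceMonomial_insert hi, map_mul, Module.End.mul_apply, ih, differenceOp_X_stepGerm,
      stepGerm_eq]
    filter_upwards [eventually_stepFilter one_pos] with p hp
    rw [strip_shiftMap hi hp.2.1.le, setIntegral_sdiff (measurableSet_strip η _ p)
      (hΔ.integrableOn_strip hg K p), sub_sub_cancel]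
    exact fun x hx => ⟨hx.1, fun j hj => hx.2 j (Finset.mem_insert_of_mem hj)⟩

end IsSmoothPolytope

theorem volume_polytope_shift (η : Fin N → Fin n → ℤ) (κ : Fin N → ℝ) (x : Fin n → ℝ) :
    volume (polytope η (κ + fun i => toReal (η i) ⬝ᵥ x)) = volume (polytope η κ) := by
  have : polytope η (κ + fun i => toReal (η i) ⬝ᵥ x) = (fun y => y + -x) ⁻¹' polytope η κ := by
    ext y
    refine forall_congr' fun i => ?_
    rw [Pi.add_apply, dotProduct_add, dotProduct_neg, ← sub_eq_add_neg, sub_le_iff_le_add]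
  rw [this, measure_preimage_add_right]

end Volume

end MassLinear

namespace MassLinear

open MeasureTheory Filter Topology MvPolynomial

section MassLinear

variable {n N : ℕ} {η : Fin N → Fin n → ℤ} {κ : Fin N → ℝ}

namespace IsSmoothPolytope

theorem eventually_integral_strip_vertex (hΔ : IsSmoothPolytope η κ) {v : Fin n → ℝ}
    (hv : v ∈ (polytope η κ).extremePoints ℝ) : ∀ᶠ p in stepFilter κ,
      ∫ _ in strip η (activeSet η κ v) p, (1 : ℝ) = p.2 ^ n := by
  filter_upwards [hΔ.eventually_strip_vertex hv, eventually_stepFilter one_pos] with p hp hp'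
  rw [hp, setIntegral_const, smul_eq_mul, mul_one, Measure.real, hΔ.volume_parallelepiped hv,
    ENNReal.toReal_pow, ENNReal.toReal_ofReal hp'.2.1.le]

/-- Mass linearity with the denominator of the barycenter cleared. The volume is nonzero because the
polytope contains the strip at a vertex, of volume ε^n. -/
theorem eventually_integral_eq (hΔ : IsSmoothPolytope η κ) {H : Fin n → ℝ} {γ : Fin N → ℝ}
    (hH : MassLinearWith η κ H γ) : ∀ᶠ p in stepFilter κ,
      (∑ j, γ j * p.1 j) * ∫ _ in polytope η p.1, (1 : ℝ) = ∫ x in polytope η p.1, H ⬝ᵥ x := by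
  obtain ⟨v, hv, -⟩ := hΔ.exists_lowest_vertex (I := ∅) 0 (by simpa [face] using hΔ.nonempty)
  filter_upwards [hΔ.eventually_mem_chamber, hΔ.eventually_integral_strip_vertex hv,
    eventually_stepFilter one_pos] with p hp hvol hp'
  have hint : IntegrableOn (fun x : Fin n → ℝ => x) (polytope η p.1) :=
    continuous_id.continuousOn.integrableOn_compact (hΔ.isCompact_polytope p.1)
  have hpos : volume.real (polytope η p.1) ≠ 0 := by
    rw [setIntegral_const, smul_eq_mul, mul_one] at hvol
    have h1 : volume.real (strip η (activeSet η κ v) p) ≤ volume.real (polytope η p.1) :=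
      measureReal_mono (fun _ hx => hx.1) (hΔ.isCompact_polytope p.1).measure_ne_top
    have h2 := pow_pos hp'.2.1 n
    linarith
  let ℓ : (Fin n → ℝ) →L[ℝ] ℝ := LinearMap.toContinuousLinearMap (dotProductBilin ℝ ℝ H)
  have hℓ : ∫ x in polytope η p.1, H ⬝ᵥ x = H ⬝ᵥ ∫ x in polytope η p.1, x :=
    ℓ.integral_comp_comm hint
  rw [← hH p.1 hp, barycenter, setAverage_eq, dotProduct_smul, hℓ, setIntegral_const]
  simp only [smul_eq_mul, mul_one]
  field_simp

theorem face_eq_empty (hΔ : IsSmoothPolytope η κ)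
    {D : MorseData (Fin N) ((polytope η κ).extremePoints ℝ)} (hI : ∀ v, D.I v = activeSet η κ v)
    {K : Finset (Fin N)} (hK : ∀ v, ¬ K ⊆ D.I v) : face η κ K = ∅ := by
  rw [← Set.not_nonempty_iff_eq_empty, hΔ.face_nonempty_iff]
  rintro ⟨v, hv, hKv⟩
  exact hK ⟨v, hv⟩ ((hI _).symm ▸ hKv)

theorem isVolumeGerm (hΔ : IsSmoothPolytope η κ) {H : Fin n → ℝ} {γ : Fin N → ℝ}
    (hH : MassLinearWith η κ H γ) {D : MorseData (Fin N) ((polytope η κ).extremePoints ℝ)}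
    {e : (polytope η κ).extremePoints ℝ → Fin N → Fin n → ℤ}
    (hI : ∀ v, D.I v = activeSet η κ v)
    (hD : ∀ v i j, D.coeff v i j = ((η j ⬝ᵥ e v i : ℤ) : ℝ)) :
    IsVolumeGerm D n γ (shiftAction κ) (stepGerm κ fun p => p.2)
      (stepGerm κ fun p => ∑ j, γ j * p.1 j)
      (stepGerm κ fun p => ∫ _ in polytope η p.1, (1 : ℝ)) where
  card_eq v := by rw [hI, hΔ.card_activeSet v.2]
  isUnit := by
    refine IsUnit.of_mul_eq_one (stepGerm κ fun p => p.2⁻¹) ?_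
    change stepGerm κ (fun p => p.2 * p.2⁻¹) = stepGerm κ 1
    rw [stepGerm_eq]
    filter_upwards [eventually_stepFilter one_pos] with p hp
    exact mul_inv_cancel₀ hp.2.1.ne'
  shift_mul u a b := map_mul (shiftGerm κ u.toAdd) a b
  shift_step u := rfl
  shift_linear u := by
    rw [shiftAction_stepGerm]
    change _ = stepGerm κ (fun p => ∑ j, γ j * p.1 j + (∑ i, u i * γ i) • p.2)
    congr 1
    ext p
    simp only [Function.comp_apply, shiftMap, toAdd_ofAdd, Pi.add_apply, Pi.smul_apply, smul_eq_mul,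
      mul_add, Finset.sum_add_distrib, Finset.sum_mul]
    congr 1
    exact Finset.sum_congr rfl fun j _ => by ring
  relation v i _ := by
    refine ⟨fun j => η j ⬝ᵥ e v i, hD v i, ?_⟩
    rw [shiftAction_stepGerm]
    congr 1
    ext p
    simp only [Function.comp_apply, setIntegral_const, Measure.real]
    congr 2
    rw [← volume_polytope_shift η p.1 (p.2 • toReal (e v i))]
    congr 3
    ext j
    simp [shiftMap, dotProduct_smul, toReal_dotProduct]
  nonface K hK := by
    rw [hΔ.differenceOp_faceMonomial continuous_const]
    refine stepGerm_eq.2 ?_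
    filter_upwards [hΔ.eventually_strip_eq_empty (hΔ.face_eq_empty hI hK)] with p hp
    simp [hp]
  -- The only use of mass linearity: L · vol is the integral of H, whose differences over a nonface
  -- are integrals over an empty strip.
  nonface_mul K hK := by
    have h1 : (stepGerm κ fun p => ∑ j, γ j * p.1 j) *
        (stepGerm κ fun p => ∫ _ in polytope η p.1, (1 : ℝ)) =
        stepGerm κ fun p => ∫ x in polytope η p.1, H ⬝ᵥ x :=
      stepGerm_eq.2 (hΔ.eventually_integral_eq hH)
    rw [h1, hΔ.differenceOp_faceMonomial (continuous_dotProduct_left H)]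
    refine stepGerm_eq.2 ?_
    filter_upwards [hΔ.eventually_strip_eq_empty (hΔ.face_eq_empty hI hK)] with p hp
    simp [hp]
  vertex v := by
    rw [hΔ.differenceOp_faceMonomial continuous_const, hI]
    exact stepGerm_eq.2 (hΔ.eventually_integral_strip_vertex v.2)

end IsSmoothPolytope

end MassLinear

end MassLinear

theorem proposition4p2 {n N : ℕ} (η : Fin N → Fin n → ℤ) (κ : Fin N → ℝ)
    (hΔ : MassLinear.IsSmoothPolytope η κ) (H : Fin n → ℝ) (γ : Fin N → ℝ)
    (hH : MassLinear.MassLinearWith η κ H γ) :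
    ∑ j, γ j = 0 ∧
      ∑ e ∈ (MassLinear.finite_directedEdges η κ).toFinset,
        MassLinear.affineLength e.1 e.2.1 * γ e.2.2 = 0 := by
  choose e he using fun v : (MassLinear.polytope η κ).extremePoints ℝ => hΔ.exists_isDualFamily v.2
  obtain ⟨D, hI, hD⟩ := hΔ.exists_morseData e he
  obtain ⟨w, hw, -⟩ := hΔ.exists_lowest_vertex (I := ∅) 0
    (by simpa [MassLinear.face] using hΔ.nonempty)
  have h := (hΔ.isVolumeGerm hH hI hD).isVolumeFunctional
  exact ⟨h.sum_coefficients_eq_zero hΔ hI he ⟨w, hw⟩, h.sum_directedEdges_eq_zero hΔ hI hD he⟩
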